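/- Let $p\ge 1$ be odd, $q\ge 2$ and $m=pq$ (so that $m\neq p$). Let $G=G(m,1,2)$ and let $H=G(m,p,2)\subseteq GL_2(\mathbb{C})$ be the group of matrices $PD$ with $P$ a permutation matrix and $D$ a diagonal matrix whose entries are $m$-th roots of unity with $\det(D)^{m/p}=1$. Let $H$ act on $S=\mathbb{C}[x,y]=\mathrm{Sym}(\mathbb{C}^2)$, where $x,y$ is the standard basis of $\mathbb{C}^2$, let $R=S^H$, and put $$z=xy(x^m-y^m),\qquad \sigma_1=(xy)^q,\qquad \sigma_2=x^m+y^m,\qquad \Delta=\sigma_1(\sigma_2^2-4\sigma_1^p)\in R.$$ For a representation $\chi$ of $H$ let $S_\chi$ be the $\chi$-isotypical component of $S$; multiplication by $z$ maps $S_\chi$ to $S_{\chi\otimes\det}$, and $M_\chi=\mathrm{Coker}(z\colon S_\chi\to S_{\chi\otimes\det})$. For distinct $i,k\in\{0,\dots,m-1\}$ let $\langle i,k\rangle$ be the two-dimensional representation of $G$ attached to the $m$-tuple of Young diagrams with one cell in position $i$, one cell in position $k$ and nothing else: it has a basis $t_1,t_2$ with $\mathrm{diag}(a,b)t_1=a^ib^kt_1$,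 $\mathrm{diag}(a,b)t_2=a^kb^it_2$, and the transposition matrix exchanges $t_1$ and $t_2$. Let $$\xi_j=\begin{pmatrix}\sigma_2&2\sigma_1^j\\2\sigma_1^{p+1-j}&\sigma_2\sigma_1\end{pmatrix},\quad \varphi_j=\begin{pmatrix}\sigma_2&2\sigma_1^j\\2\sigma_1^{p-j}&\sigma_2\end{pmatrix},\quad \psi_j=\begin{pmatrix}\sigma_2\sigma_1&-2\sigma_1^{j+1}\\-2\sigma_1^{p+1-j}&\sigma_2\sigma_1\end{pmatrix}$$ and let $X_j,K_j,N_j$ be the cokernels of $\xi_j$, $\varphi_j$, $\psi_j$, respectively, acting on column vectors in $R^2$. Then $S/(z)$ is an $R/(\Delta)$-module; every $\mathrm{Res}^G_H\langle i,k\rangle$ is irreducible, and the natural map $M_{\mathrm{Res}^G_H\langle i,k\rangle}\to S/(z)$ is injective onto a direct summand. Every two-dimensional irreducible representation of $H$ is isomorphic to one of those listed in 1)–3), and there are the following isomorphisms of $R/(\Delta)$-modules: 1) $M_{\mathrm{Res}^G_H\langle i,\,jq-1\rangle}\cong X_{p+1-j}^2$ for $0\le i<q-1$ and $1\le j\le p$;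 2) $M_{\mathrm{Res}^G_H\langle i,\,jq+r\rangle}\cong K_{p-j}^2\cong K_j^2$ for $0\le j\le p-1$, $0\le i<q-1$, $0\le r<q-1$ with $i\neq jq+r$; 3) $M_{\mathrm{Res}^G_H\langle q-1,\,(j+1)q-1\rangle}\cong N_{p-j}^2\cong N_j^2$ for $1\le j\le p-1$. -/

import Mathlib

noncomputable section

namespace ReflDisc

open MvPolynomial

/-- The polynomial ring `S = ℂ[x, y]`, with `x = X 0` and `y = X 1`. -/
abbrev S : Type := MvPolynomial (Fin 2) ℂ

/-- The linear substitution `x_k ↦ ∑ l, g l k • x_l`: the action of the matrix `g` on `S = Sym(V)`,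
where `x, y` is the standard basis of `V = ℂ²`. -/
def subst (g : Matrix (Fin 2) (Fin 2) ℂ) : S →ₐ[ℂ] S :=
  aeval fun k => ∑ l, C (g l k) * X l

theorem subst_X (g : Matrix (Fin 2) (Fin 2) ℂ) (k : Fin 2) :
    subst g (X k) = C (g 0 k) * X 0 + C (g 1 k) * X 1 := by
  simp [subst]

theorem subst_one : subst 1 = AlgHom.id ℂ S := by
  apply MvPolynomial.algHom_ext
  intro k
  rw [subst_X]
  match k with
  | 0 => simp
  | 1 => simp

theorem subst_mul (g h : Matrix (Fin 2) (Fin 2) ℂ) :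
    subst (g * h) = (subst g).comp (subst h) := by
  apply MvPolynomial.algHom_ext
  intro k
  simp only [AlgHom.comp_apply, subst_X, map_add, map_mul, Matrix.mul_apply, Fin.sum_univ_two,
    ← MvPolynomial.algebraMap_eq, AlgHom.commutes]
  ring

/-- The matrices `P D` with `P` a permutation matrix and `D` a diagonal matrix whose entries are
`m`-th roots of unity and which satisfies `det(D)^(m/p) = 1`. -/
def IsMonomial (m p : ℕ) (g : Matrix (Fin 2) (Fin 2) ℂ) : Prop :=
  ∃ (σ : Equiv.Perm (Fin 2)) (d : Fin 2 → ℂ), (∀ k, d k ^ m = 1) ∧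
    (Matrix.diagonal d).det ^ (m / p) = 1 ∧ g = σ.permMatrix ℂ * Matrix.diagonal d

theorem isMonomial_iff (m p : ℕ) (g : Matrix (Fin 2) (Fin 2) ℂ) :
    IsMonomial m p g ↔ ∃ a b : ℂ, a ^ m = 1 ∧ b ^ m = 1 ∧ (a * b) ^ (m / p) = 1 ∧
      (g = !![a, 0; 0, b] ∨ g = !![0, b; a, 0]) := by
  have h1 : ∀ a b : ℂ, (1 : Equiv.Perm (Fin 2)).permMatrix ℂ * Matrix.diagonal ![a, b]
      = !![a, 0; 0, b] := by
    intro a b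
    ext i j
    fin_cases i <;> fin_cases j <;> simp
  have h2 : ∀ a b : ℂ, (Equiv.swap (0 : Fin 2) 1).permMatrix ℂ * Matrix.diagonal ![a, b]
      = !![0, b; a, 0] := by
    intro a b
    ext i j
    fin_cases i <;> fin_cases j <;> simp [PEquiv.toMatrix_apply]
  constructor
  · rintro ⟨σ, d, hd, hdet, rfl⟩
    have hd' : d = ![d 0, d 1] := by
      ext k
      fin_cases k <;> rfl
    refine ⟨d 0, d 1, hd 0, hd 1, by simpa using hdet, ?_⟩
    have hs : σ = 1 ∨ σ = Equiv.swap 0 1 := by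
      revert σ
      decide
    rcases hs with rfl | rfl
    · left
      rw [← h1, ← hd']
    · right
      rw [← h2, ← hd']
  · rintro ⟨a, b, ha, hb, hab, rfl | rfl⟩
    · exact ⟨1, ![a, b], by intro k; fin_cases k <;> simpa, by simpa using hab, (h1 a b).symm⟩
    · exact ⟨Equiv.swap 0 1, ![a, b], by intro k; fin_cases k <;> simpa, by simpa using hab,
        (h2 a b).symm⟩

/-- The complex reflection group `G(m, p, 2)`. -/
def G (m p : ℕ) : Subgroup (GL (Fin 2) ℂ) where
  carrier := {g | IsMonomial m p (g : Matrix (Fin 2) (Fin 2) ℂ)}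
  one_mem' := by
    refine (isMonomial_iff _ _ _).2 ⟨1, 1, by simp, by simp, by simp, Or.inl ?_⟩
    simp [Matrix.one_fin_two]
  mul_mem' := by
    intro g h hg hh
    obtain ⟨a, b, ha, hb, hab, hg⟩ := (isMonomial_iff _ _ _).1 hg
    obtain ⟨c, d, hc, hd, hcd, hh⟩ := (isMonomial_iff _ _ _).1 hh
    refine (isMonomial_iff _ _ _).2 ?_
    have e1 : (a * c * (b * d)) ^ (m / p) = 1 := by
      rw [show a * c * (b * d) = a * b * (c * d) by ring, mul_pow, hab, hcd, one_mul]
    have e2 : (b * c * (a * d)) ^ (m / p) = 1 := by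
      rw [show b * c * (a * d) = a * b * (c * d) by ring, mul_pow, hab, hcd, one_mul]
    rw [Units.val_mul]
    rcases hg with hg | hg <;> rcases hh with hh | hh <;> rw [hg, hh]
    · exact ⟨a * c, b * d, by simp [mul_pow, *], by simp [mul_pow, *], e1, Or.inl (by simp)⟩
    · exact ⟨b * c, a * d, by simp [mul_pow, *], by simp [mul_pow, *], e2, Or.inr (by simp)⟩
    · exact ⟨a * c, b * d, by simp [mul_pow, *], by simp [mul_pow, *], e1, Or.inr (by simp)⟩
    · exact ⟨b * c, a * d, by simp [mul_pow, *], by simp [mul_pow, *], e2, Or.inl (by simp)⟩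
  inv_mem' := by
    intro g hg
    obtain ⟨a, b, ha, hb, hab, hg⟩ := (isMonomial_iff _ _ _).1 hg
    refine (isMonomial_iff _ _ _).2 ?_
    have hdet : (g : Matrix (Fin 2) (Fin 2) ℂ).det ≠ 0 := by
      have := (Matrix.isUnit_iff_isUnit_det _).1 g.isUnit
      exact this.ne_zero
    have hab0 : a * b ≠ 0 := by
      intro h0
      apply hdet
      rcases hg with hg | hg <;> rw [hg, Matrix.det_fin_two_of]
      · linear_combination h0
      · linear_combination -h0
    have ha0 : a ≠ 0 := left_ne_zero_of_mul hab0
    have hb0 : b ≠ 0 := right_ne_zero_of_mul hab0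
    rcases hg with hg | hg
    · refine ⟨a⁻¹, b⁻¹, by simp [ha], by simp [hb], by rw [← mul_inv, inv_pow, hab, inv_one],
        Or.inl ?_⟩
      rw [Matrix.coe_units_inv, hg]
      apply Matrix.inv_eq_left_inv
      simp [Matrix.one_fin_two, ha0, hb0]
    · refine ⟨b⁻¹, a⁻¹, by simp [hb], by simp [ha],
        by rw [← mul_inv, inv_pow, mul_comm, hab, inv_one], Or.inr ?_⟩
      rw [Matrix.coe_units_inv, hg]
      apply Matrix.inv_eq_left_inv
      simp [Matrix.one_fin_two, ha0, hb0]

variable (m p : ℕ)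

/-- The matrix of an element of `G(m, p, 2)`. -/
abbrev mat {m p : ℕ} (g : G m p) : Matrix (Fin 2) (Fin 2) ℂ := ((g : GL (Fin 2) ℂ) : Matrix _ _ ℂ)

theorem mat_cases {m p : ℕ} (g : G m p) : ∃ a b : ℂ, a ^ m = 1 ∧ b ^ m = 1 ∧
    (a * b) ^ (m / p) = 1 ∧ (mat g = !![a, 0; 0, b] ∨ mat g = !![0, b; a, 0]) :=
  (isMonomial_iff _ _ _).1 g.2

theorem G_le : G m p ≤ G m 1 := by
  intro g hg
  obtain ⟨a, b, ha, hb, -, hg⟩ := (isMonomial_iff _ _ _).1 hg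
  exact (isMonomial_iff _ _ _).2 ⟨a, b, ha, hb, by simp [mul_pow, ha, hb], hg⟩

/-- The representation of `G(m, p, 2)` on `S`. -/
def polyRep : Representation ℂ (G m p) S where
  toFun g := (subst (mat g)).toLinearMap
  map_one' := by
    simp only [mat, Subgroup.coe_one, Units.val_one, subst_one]
    rfl
  map_mul' g h := by
    simp only [mat, Subgroup.coe_mul, Units.val_mul, subst_mul]
    rfl

/-- The subalgebra `S^H` of invariants of `H = G(m, p, 2)`. -/
def invariants : Subalgebra ℂ S where
  carrier := {s | ∀ g : G m p, polyRep m p g s = s}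
  mul_mem' := by
    intro a b ha hb g
    have ha := ha g
    have hb := hb g
    simp only [polyRep, MonoidHom.coe_mk, OneHom.coe_mk, AlgHom.toLinearMap_apply] at ha hb ⊢
    rw [map_mul, ha, hb]
  add_mem' := by
    intro a b ha hb g
    rw [map_add, ha g, hb g]
  algebraMap_mem' := by
    intro c g
    exact (subst (mat g)).commutes c

/-- The invariant ring `R = S^H`, `H = G(m, p, 2)`, as a ring over which `S` is an algebra. -/
def R : Type := invariants m p

instance : CommRing (R m p) := inferInstanceAs (CommRing (invariants m p))

instance : Algebra (R m p) S := inferInstanceAs (Algebra (invariants m p) S)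

/-- `z = xy(x^m - y^m)`, the reduced equation of the hyperplane arrangement of `G(m, p, 2)` for
`p ≠ m`. -/
def z : S := X 0 * X 1 * (X 0 ^ m - X 1 ^ m)

theorem polyRep_z (g : G m p) : polyRep m p g (z m) = (mat g).det • z m := by
  obtain ⟨a, b, ha, hb, -, hg⟩ := mat_cases g
  have hCa : (C a : S) ^ m = 1 := by rw [← C_pow, ha, C_1]
  have hCb : (C b : S) ^ m = 1 := by rw [← C_pow, hb, C_1]
  change subst (mat g) (z m) = _
  simp only [z, map_mul, map_sub, map_pow, subst_X, smul_eq_C_mul]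
  rcases hg with hg | hg <;>
    simp only [hg, Matrix.det_fin_two_of, Matrix.of_apply, Matrix.cons_val', Matrix.cons_val_zero,
      Matrix.cons_val_one, Matrix.cons_val_fin_one, C_0, zero_mul, add_zero,
      zero_add, mul_pow, hCa, hCb, C_mul, C_sub, mul_zero] <;> ring

/-- The invariant `σ₁ = (xy)^q`, `q = m / p`. -/
def σ₁ : R m p := ⟨(X 0 * X 1) ^ (m / p), by
  intro g
  obtain ⟨a, b, -, -, hab, hg⟩ := mat_cases g
  have hC : (C a * C b : S) ^ (m / p) = 1 := by rw [← C_mul, ← C_pow, hab, C_1]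
  change subst (mat g) _ = _
  rw [map_pow, map_mul, subst_X, subst_X]
  rcases hg with hg | hg
  · have : (C (mat g 0 0) * X 0 + C (mat g 1 0) * X 1) * (C (mat g 0 1) * X 0 + C (mat g 1 1) * X 1)
        = (C a * C b) * (X 0 * X 1 : S) := by
      simp [hg]; ring
    rw [this, mul_pow, hC, one_mul]
  · have : (C (mat g 0 0) * X 0 + C (mat g 1 0) * X 1) * (C (mat g 0 1) * X 0 + C (mat g 1 1) * X 1)
        = (C a * C b) * (X 0 * X 1 : S) := by
      simp [hg]; ring
    rw [this, mul_pow, hC, one_mul]⟩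

/-- The invariant `σ₂ = x^m + y^m`. -/
def σ₂ : R m p := ⟨X 0 ^ m + X 1 ^ m, by
  intro g
  obtain ⟨a, b, ha, hb, -, hg⟩ := mat_cases g
  have hCa : (C a : S) ^ m = 1 := by rw [← C_pow, ha, C_1]
  have hCb : (C b : S) ^ m = 1 := by rw [← C_pow, hb, C_1]
  change subst (mat g) _ = _
  rw [map_add, map_pow, map_pow, subst_X, subst_X]
  rcases hg with hg | hg
  · simp [hg, mul_pow, hCa, hCb]
  · simp [hg, mul_pow, hCa, hCb, add_comm]⟩

/-- The discriminant `Δ = σ₁(σ₂² - 4σ₁^p)`. -/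
def Δ : R m p := σ₁ m p * (σ₂ m p ^ 2 - 4 * σ₁ m p ^ p)

/-- The ideal `(Δ)` of `R`. -/
def discIdeal : Ideal (R m p) := Ideal.span {Δ m p}

/-- The module `S/(z)`. -/
abbrev SmodZ : Type := S ⧸ Ideal.span {z m}

section Isotypic

variable {m p} {W : Type*} [AddCommGroup W] [Module ℂ W]

/-- The twist `ρ ⊗ det` of a representation of `G(m, p, 2)`, on the same space. -/
def twistDet (ρ : Representation ℂ (G m p) W) : Representation ℂ (G m p) W where
  toFun g := (mat g).det • ρ g
  map_one' := by simp [mat]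
  map_mul' g h := by
    ext w
    simp [mat, mul_smul]
    rw [smul_comm]

/-- The isotypical component `S_ρ` of `S`: the sum of the images of all `H`-equivariant maps from
`ρ` to `S`. For irreducible `ρ` the nonzero images are the subrepresentations of `S`
isomorphic to `ρ`. An invariant times an equivariant map is equivariant, so that the `R`-span is
the same as the `ℂ`-span. -/
def isotypic (ρ : Representation ℂ (G m p) W) : Submodule (R m p) S :=
  Submodule.span (R m p) {s | ∃ (f : ρ.IntertwiningMap (polyRep m p)) (w : W), f w = s}

theorem z_mul_mem (ρ : Representation ℂ (G m p) W) (s : S) (hs : s ∈ isotypic ρ) :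
    LinearMap.mulLeft (R m p) (z m) s ∈ isotypic (twistDet ρ) := by
  induction hs using Submodule.span_induction with
  | mem s hs =>
    obtain ⟨f, w, rfl⟩ := hs
    apply Submodule.subset_span
    refine ⟨⟨LinearMap.mulLeft ℂ (z m) ∘ₗ f.toLinearMap, ?_⟩, w, rfl⟩
    intro g
    ext w : 1
    have h1 : f (ρ g w) = polyRep m p g (f w) := Representation.IntertwiningMap.isIntertwining _ _ f g w
    have h2 : polyRep m p g (z m * f w) = polyRep m p g (z m) * polyRep m p g (f w) :=
      map_mul (subst (mat g)) _ _
    have h3 : f ((mat g).det • ρ g w) = (mat g).det • f (ρ g w) := map_smul f.toLinearMap _ _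
    change z m * f ((mat g).det • ρ g w) = polyRep m p g (z m * f w)
    rw [h3, h2, h1, polyRep_z, smul_mul_assoc, mul_smul_comm]
  | zero => simp
  | add a b _ _ ha hb =>
    rw [map_add]
    exact add_mem ha hb
  | smul r a _ ha =>
    rw [map_smul]
    exact Submodule.smul_mem _ _ ha

/-- Multiplication by `z` from the isotypical component of `ρ` to that of `ρ ⊗ det`. -/
def zRestrict (ρ : Representation ℂ (G m p) W) :
    isotypic ρ →ₗ[R m p] isotypic (twistDet ρ) :=
  (LinearMap.mulLeft (R m p) (z m)).restrict (z_mul_mem ρ)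

/-- `M_ρ = Coker (z|_ρ : S_ρ → S_{ρ ⊗ det})`. -/
abbrev M (ρ : Representation ℂ (G m p) W) : Type :=
  isotypic (twistDet ρ) ⧸ LinearMap.range (zRestrict ρ)

/-- The natural map `M_ρ → S/(z)` induced by the inclusion of `S_{ρ ⊗ det}` in `S`. -/
def toSmodZ (ρ : Representation ℂ (G m p) W) : M ρ →ₗ[R m p] SmodZ m :=
  (LinearMap.range (zRestrict ρ)).liftQ
    ((Ideal.Quotient.mkₐ (R m p) (Ideal.span {z m})).toLinearMap ∘ₗ (isotypic (twistDet ρ)).subtype)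
    (by
      rintro _ ⟨s, rfl⟩
      rw [LinearMap.mem_ker]
      change Ideal.Quotient.mk (Ideal.span {z m}) (z m * (s : S)) = 0
      rw [Ideal.Quotient.eq_zero_iff_mem]
      exact Ideal.mul_mem_right _ _ (Ideal.mem_span_singleton_self _))

end Isotypic

/-- The matrix by which `g ∈ G(m, 1, 2)` acts on the representation `⟨i, k⟩`, in the basis `t₁, t₂`,
where `t₁` is the tableau with `1` in position `i` and `2` in position `k`, and `t₂` the one with
`2` in position `i` and `1` in position `k`: a diagonal matrix `diag(a, b)` acts by
`t₁ ↦ a^i b^k t₁` and `t₂ ↦ a^k b^i t₂`, and the transposition exchanges `t₁` and `t₂`. -/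
def pairMatrix (i k : ℕ) (g : Matrix (Fin 2) (Fin 2) ℂ) : Matrix (Fin 2) (Fin 2) ℂ :=
  open Classical in
  if g 0 1 = 0 then !![g 0 0 ^ i * g 1 1 ^ k, 0; 0, g 0 0 ^ k * g 1 1 ^ i]
  else !![0, g 1 0 ^ k * g 0 1 ^ i; g 1 0 ^ i * g 0 1 ^ k, 0]

theorem mat_cases' {m p : ℕ} (g : G m p) : ∃ a b : ℂ, a ≠ 0 ∧ b ≠ 0 ∧
    (mat g = !![a, 0; 0, b] ∨ mat g = !![0, b; a, 0]) := by
  obtain ⟨a, b, -, -, -, hg⟩ := mat_cases g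
  have hdet : (mat g).det ≠ 0 :=
    ((Matrix.isUnit_iff_isUnit_det _).1 (g : GL (Fin 2) ℂ).isUnit).ne_zero
  refine ⟨a, b, ?_, ?_, hg⟩ <;> rintro rfl <;> rcases hg with hg | hg <;>
    simp [hg, Matrix.det_fin_two_of] at hdet

/-- The representation `⟨i, k⟩` of `G(m, 1, 2)`, attached to the `m`-tuple of Young diagrams with one
cell in position `i`, one cell in position `k` and nothing else. -/
def pairRep (i k : ℕ) : Representation ℂ (G m 1) (Fin 2 → ℂ) where
  toFun g := Matrix.toLin' (pairMatrix i k (mat g))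
  map_one' := by
    simp only [mat, Subgroup.coe_one, Units.val_one]
    rw [show pairMatrix i k 1 = 1 by simp [pairMatrix, Matrix.one_fin_two], Matrix.toLin'_one]
    rfl
  map_mul' g h := by
    rw [Module.End.mul_eq_comp, ← Matrix.toLin'_mul]
    congr 1
    obtain ⟨a, b, ha, hb, hg⟩ := mat_cases' g
    obtain ⟨c, d, hc, hd, hh⟩ := mat_cases' h
    have e : mat (g * h) = mat g * mat h := rfl
    rw [e]
    rcases hg with hg | hg <;> rcases hh with hh | hh <;>
      simp [hg, hh, pairMatrix, ha, hb, hd, mul_pow] <;>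
      (refine ⟨?_, ?_⟩ <;> ring)

/-- The restriction of `⟨i, k⟩` to `H = G(m, p, 2)`. -/
def resPair (i k : ℕ) : Representation ℂ (G m p) (Fin 2 → ℂ) :=
  (pairRep m i k).comp (Subgroup.inclusion (G_le m p))

/-- The cokernel of a square matrix over `R`, acting on column vectors. -/
abbrev Coker {A : Type*} [CommRing A] (φ : Matrix (Fin 2) (Fin 2) A) : Type _ :=
  (Fin 2 → A) ⧸ LinearMap.range φ.mulVecLin

/-- `φ_j`, for `0 ≤ j ≤ p`. -/
def φMat (j : ℕ) : Matrix (Fin 2) (Fin 2) (R m p) :=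
  !![σ₂ m p, 2 * σ₁ m p ^ j; 2 * σ₁ m p ^ (p - j), σ₂ m p]

/-- `ψ_j`, for `0 ≤ j ≤ p`. -/
def ψMat (j : ℕ) : Matrix (Fin 2) (Fin 2) (R m p) :=
  !![σ₂ m p * σ₁ m p, -2 * σ₁ m p ^ (j + 1); -2 * σ₁ m p ^ (p + 1 - j), σ₂ m p * σ₁ m p]

/-- `ξ_j`, for `0 ≤ j ≤ p + 1`. -/
def ξMat (j : ℕ) : Matrix (Fin 2) (Fin 2) (R m p) :=
  !![σ₂ m p, 2 * σ₁ m p ^ j; 2 * σ₁ m p ^ (p + 1 - j), σ₂ m p * σ₁ m p]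

/-- `X_j = Coker (ξ_j)`. -/
abbrev XMod (j : ℕ) : Type := Coker (ξMat m p j)

/-- `K_j = Coker (φ_j)`. -/
abbrev KMod (j : ℕ) : Type := Coker (φMat m p j)

/-- `N_j = Coker (ψ_j)`. -/
abbrev NMod (j : ℕ) : Type := Coker (ψMat m p j)

/-- `M` and `N` are annihilated by `I` and isomorphic as modules over `A/I`. -/
def IsoMod {A : Type*} [CommRing A] (I : Ideal A) (M N : Type*) [AddCommGroup M] [Module A M]
    [AddCommGroup N] [Module A N] : Prop :=
  ∃ (hM : Module.IsTorsionBySet A M I) (hN : Module.IsTorsionBySet A N I),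
    letI := hM.module
    letI := hN.module
    Nonempty (M ≃ₗ[A ⧸ I] N)

end ReflDisc

end
/-!
The diagonal matrices in `H` split every representation into weight spaces, which the transposition
swaps in pairs. Two weights `(i, k)` define the same character exactly when their classes in
`ZMod m × ZMod q` agree, so every weight can be moved to `(a, jq + b)` with `a, b < q` and `j < p`.
In that form the weight space of `S` is free over `R` with basis `x ^ a * y ^ (jq + b)` and
`x ^ ((p - j)q + a) * y ^ b`, and `S_ρ` is isomorphic to two copies of it. Multiplication by `z`
raises both exponents by one, and in these bases its matrix is `φ` when neither `a + 1` nor `b + 1`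
reaches `q`. When one or both of them do, the target basis has to be renormalised by a factor
`σ₁`, which turns `φ` into `ξ` or `ψ`. Since `z` is a weight vector, the weight projections of `S`
commute with multiplication by `z` and induce retractions of `S/(z)` onto the modules `M_ρ`.
-/

noncomputable section

namespace ReflDisc

open MvPolynomial

/-! ### Diagonal elements and the transposition -/

section Elements

variable {m p q : ℕ}

theorem mat_injective : Function.Injective (mat : G m p → Matrix (Fin 2) (Fin 2) ℂ) :=
  fun _ _ h => Subtype.ext (Units.ext h)

theorem mat_one : mat (1 : G m p) = 1 := rfl

theorem mat_mul (g h : G m p) : mat (g * h) = mat g * mat h := rfl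

theorem mat_pow (g : G m p) (n : ℕ) : mat (g ^ n) = mat g ^ n := by
  simp only [mat, SubmonoidClass.coe_pow, Units.val_pow_eq_pow_val]

theorem diag_mul (a b c d : ℂ) :
    !![a, 0; 0, b] * !![c, 0; 0, d] = !![a * c, 0; 0, b * d] := by
  simp

theorem diag_pow (a b : ℂ) (n : ℕ) : !![a, 0; 0, b] ^ n = !![a ^ n, 0; 0, b ^ n] := by
  induction n with
  | zero => simp [Matrix.one_fin_two]
  | succ n ih => rw [pow_succ, ih, diag_mul, pow_succ, pow_succ]

theorem exists_mat_eq_diag (hm : m ≠ 0) {a b : ℂ} (ha : a ^ m = 1) (hb : b ^ m = 1)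
    (hab : (a * b) ^ (m / p) = 1) : ∃ g : G m p, mat g = !![a, 0; 0, b] := by
  have ha0 : a ≠ 0 := ne_zero_pow hm (ha ▸ one_ne_zero)
  have hb0 : b ≠ 0 := ne_zero_pow hm (hb ▸ one_ne_zero)
  refine ⟨⟨Matrix.GeneralLinearGroup.mkOfDetNeZero !![a, 0; 0, b] (by simp [ha0, hb0]), ?_⟩, rfl⟩
  exact (isMonomial_iff _ _ _).2 ⟨a, b, ha, hb, hab, Or.inl rfl⟩

theorem pow_eq_one_of_mat_eq_diag {g : G m p} {a b : ℂ} (hg : mat g = !![a, 0; 0, b]) :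
    a ^ m = 1 ∧ b ^ m = 1 ∧ (a * b) ^ (m / p) = 1 := by
  obtain ⟨a', b', ha', hb', hab', hg' | hg'⟩ := mat_cases g
  · obtain ⟨rfl, rfl⟩ : a = a' ∧ b = b' := by
      simpa [← Matrix.ext_iff, Fin.forall_fin_two] using hg.symm.trans hg'
    exact ⟨ha', hb', hab'⟩
  · have hdet : (mat g).det ≠ 0 :=
      ((Matrix.isUnit_iff_isUnit_det _).1 (g : GL (Fin 2) ℂ).isUnit).ne_zero
    have ha0 : a = 0 := congrFun (congrFun (hg.symm.trans hg') 0) 0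
    simp [hg, ha0] at hdet

/-- The transposition matrix, as an element of `G(m, p, 2)`. -/
def swapElem (m p : ℕ) : G m p :=
  ⟨Matrix.GeneralLinearGroup.mkOfDetNeZero !![0, 1; 1, 0] (by simp),
    (isMonomial_iff _ _ _).2 ⟨1, 1, one_pow m, one_pow m, by simp, Or.inr rfl⟩⟩

theorem mat_swapElem : mat (swapElem m p) = !![0, 1; 1, 0] := rfl

theorem swapElem_mul_self : swapElem m p * swapElem m p = 1 :=
  mat_injective (by simp [mat_mul, mat_swapElem, mat_one, Matrix.one_fin_two])

theorem mat_swapElem_mul_mul_swapElem {g : G m p} {a b : ℂ} (hg : mat g = !![a, 0; 0, b]) :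
    mat (swapElem m p * g * swapElem m p) = !![b, 0; 0, a] := by
  simp [mat_mul, mat_swapElem, hg]

theorem eq_diag_or_eq_swapElem_mul_diag (g : G m p) : ∃ (d : G m p) (a b : ℂ),
    mat d = !![a, 0; 0, b] ∧ (g = d ∨ g = swapElem m p * d) := by
  obtain ⟨a, b, -, -, -, hg | hg⟩ := mat_cases g
  · exact ⟨g, a, b, hg, Or.inl rfl⟩
  · refine ⟨swapElem m p * g, a, b, by simp [mat_mul, mat_swapElem, hg], Or.inr ?_⟩
    rw [← mul_assoc, swapElem_mul_self, one_mul]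

theorem diag_swap_induction {P : G m p → Prop}
    (diag : ∀ {g : G m p} {a b : ℂ}, mat g = !![a, 0; 0, b] → P g) (swap : P (swapElem m p))
    (mul : ∀ g h, P g → P h → P (g * h)) (g : G m p) : P g := by
  obtain ⟨d, a, b, hd, rfl | rfl⟩ := eq_diag_or_eq_swapElem_mul_diag g
  · exact diag hd
  · exact mul _ _ swap (diag hd)

theorem p_pos_of_eq_mul (hpq : m = p * q) (hm : 0 < m) : 0 < p :=
  Nat.pos_of_mul_pos_right (hpq ▸ hm)

theorem q_pos_of_eq_mul (hpq : m = p * q) (hm : 0 < m) : 0 < q :=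
  Nat.pos_of_mul_pos_left (hpq ▸ hm)

theorem exists_diag_generators (hpq : m = p * q) (hm : 0 < m) :
    ∃ (ζ : ℂ) (g₁ g₂ : G m p), IsPrimitiveRoot ζ m ∧ mat g₁ = !![ζ, 0; 0, ζ⁻¹] ∧
      mat g₂ = !![1, 0; 0, ζ ^ p] := by
  have hζ := Complex.isPrimitiveRoot_exp m hm.ne'
  set ζ := Complex.exp (2 * Real.pi * Complex.I / m)
  have hζ0 : ζ ≠ 0 := hζ.ne_zero hm.ne'
  have hdiv : m / p = q := Nat.div_eq_of_eq_mul_right (p_pos_of_eq_mul hpq hm) hpq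
  obtain ⟨g₁, h₁⟩ := exists_mat_eq_diag (p := p) hm.ne' hζ.pow_eq_one
    (by rw [inv_pow, hζ.pow_eq_one, inv_one]) (by rw [mul_inv_cancel₀ hζ0, one_pow])
  obtain ⟨g₂, h₂⟩ := exists_mat_eq_diag (p := p) hm.ne' (one_pow m)
    (show (ζ ^ p) ^ m = 1 by rw [pow_right_comm, hζ.pow_eq_one, one_pow])
    (by rw [one_mul, hdiv, ← pow_mul, ← hpq, hζ.pow_eq_one])
  exact ⟨ζ, g₁, g₂, hζ, h₁, h₂⟩

theorem exists_eq_pow_mul_pow (hpq : m = p * q) (hm : 0 < m) {ζ : ℂ} (hζ : IsPrimitiveRoot ζ m)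
    {g₁ g₂ g : G m p} (h₁ : mat g₁ = !![ζ, 0; 0, ζ⁻¹]) (h₂ : mat g₂ = !![1, 0; 0, ζ ^ p]) {a b : ℂ}
    (hg : mat g = !![a, 0; 0, b]) : ∃ s t : ℕ, g = g₁ ^ s * g₂ ^ t := by
  have hζ0 : ζ ≠ 0 := hζ.ne_zero hm.ne'
  have : NeZero m := ⟨hm.ne'⟩
  have : NeZero q := ⟨(q_pos_of_eq_mul hpq hm).ne'⟩
  obtain ⟨ha, -, hab⟩ := pow_eq_one_of_mat_eq_diag hg
  rw [Nat.div_eq_of_eq_mul_right (p_pos_of_eq_mul hpq hm) hpq] at hab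
  obtain ⟨s, -, rfl⟩ := hζ.eq_pow_of_pow_eq_one ha
  obtain ⟨t, -, ht⟩ := (hζ.pow hm hpq).eq_pow_of_pow_eq_one hab
  have hb : b = ζ⁻¹ ^ s * (ζ ^ p) ^ t := by
    rw [ht, ← mul_assoc, ← mul_pow, inv_mul_cancel₀ hζ0, one_pow, one_mul]
  refine ⟨s, t, mat_injective ?_⟩
  rw [mat_mul, mat_pow, mat_pow, h₁, h₂, diag_pow, diag_pow, diag_mul, one_pow, mul_one, hg, hb]

end Elements

/-! ### Characters of the diagonal subgroup -/

section Characters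

variable {m p q i k i' k' : ℕ}

/-- The class of the character `diag(a, b) ↦ a^i b^k` of the diagonal subgroup of `G(pq, p, 2)`. As
`diag(a, b) ↦ (a, ab)` identifies this subgroup with the product of the groups of roots of unity of
orders `m` and `q`, its character group is `ZMod m × ZMod q`. -/
def charClass (m q i k : ℕ) : ZMod m × ZMod q := ((i : ZMod m) - k, (k : ZMod q))

/-- The weights of `x` and `y` in the grading of `S` by the characters of the diagonal subgroup. -/
def charWeight (m q : ℕ) : Fin 2 → ZMod m × ZMod q := ![(1, 0), (-1, 1)]

theorem weight_charWeight (m q : ℕ) (d : Fin 2 →₀ ℕ) :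
    Finsupp.weight (charWeight m q) d = charClass m q (d 0) (d 1) := by
  rw [Finsupp.weight_apply, Finsupp.sum_fintype _ _ (by simp)]
  ext <;> simp [charWeight, charClass, Fin.sum_univ_two, sub_eq_add_neg]

theorem charClass_add (m q i k i' k' : ℕ) :
    charClass m q (i + i') (k + k') = charClass m q i k + charClass m q i' k' := by
  simp only [charClass, Prod.mk_add_mk, Nat.cast_add]
  congr 1
  ring

theorem charClass_eq_iff : charClass m q i k = charClass m q i' k' ↔
    (m : ℤ) ∣ (i - k) - (i' - k') ∧ (q : ℤ) ∣ k - k' := by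
  simp only [charClass, Prod.mk.injEq, ← ZMod.intCast_zmod_eq_zero_iff_dvd, Int.cast_sub,
    Int.cast_natCast, sub_eq_zero]

theorem charClass_eq_swap_iff : charClass m q i k = charClass m q k i ↔
    (m : ℤ) ∣ 2 * (i - k) ∧ (q : ℤ) ∣ i - k := by
  rw [charClass_eq_iff, ← dvd_neg (b := (k - i : ℤ)), neg_sub,
    show ((i : ℤ) - k) - (k - i) = 2 * (i - k) by ring]

theorem charClass_succ_ne_swap (h : charClass m q i k ≠ charClass m q k i) :
    charClass m q (i + 1) (k + 1) ≠ charClass m q (k + 1) (i + 1) := by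
  rwa [charClass_add, charClass_add, Ne, add_left_inj]

theorem zpow_eq_zpow_of_dvd_sub {a : ℂ} {n : ℕ} (hn : n ≠ 0) (ha : a ^ n = 1) {u v : ℤ}
    (h : (n : ℤ) ∣ u - v) : a ^ u = a ^ v := by
  have ha0 : a ≠ 0 := ne_zero_pow hn (ha ▸ one_ne_zero)
  obtain ⟨t, ht⟩ := h
  rw [← sub_add_cancel u v, ht, zpow_add₀ ha0, zpow_mul, zpow_natCast, ha, one_zpow, one_mul]

theorem pow_mul_pow_eq_zpow_mul_pow {a : ℂ} (ha : a ≠ 0) (b : ℂ) (i k : ℕ) :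
    a ^ i * b ^ k = a ^ ((i : ℤ) - k) * (a * b) ^ k := by
  rw [zpow_sub₀ ha, zpow_natCast, zpow_natCast, mul_pow]
  field_simp

theorem pow_mul_pow_eq_of_charClass_eq (hpq : m = p * q) (hm : 0 < m)
    (h : charClass m q i k = charClass m q i' k') {g : G m p} {a b : ℂ}
    (hg : mat g = !![a, 0; 0, b]) : a ^ i * b ^ k = a ^ i' * b ^ k' := by
  obtain ⟨ha, -, hab⟩ := pow_eq_one_of_mat_eq_diag hg
  rw [Nat.div_eq_of_eq_mul_right (p_pos_of_eq_mul hpq hm) hpq] at hab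
  have ha0 : a ≠ 0 := ne_zero_pow hm.ne' (ha ▸ one_ne_zero)
  obtain ⟨h₁, h₂⟩ := charClass_eq_iff.1 h
  rw [pow_mul_pow_eq_zpow_mul_pow ha0, pow_mul_pow_eq_zpow_mul_pow ha0,
    zpow_eq_zpow_of_dvd_sub hm.ne' ha h₁, ← zpow_natCast (a * b) k, ← zpow_natCast (a * b) k',
    zpow_eq_zpow_of_dvd_sub (q_pos_of_eq_mul hpq hm).ne' hab h₂]

theorem charClass_eq_of_pow_mul_pow_eq (hpq : m = p * q) (hm : 0 < m)
    (h : ∀ {g : G m p} {a b : ℂ}, mat g = !![a, 0; 0, b] → a ^ i * b ^ k = a ^ i' * b ^ k') :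
    charClass m q i k = charClass m q i' k' := by
  obtain ⟨ζ, g₁, g₂, hζ, h₁, h₂⟩ := exists_diag_generators hpq hm
  have hζ0 : ζ ≠ 0 := hζ.ne_zero hm.ne'
  have hζp0 : ζ ^ p ≠ 0 := pow_ne_zero _ hζ0
  rw [charClass_eq_iff]
  constructor
  · rw [← hζ.zpow_eq_one_iff_dvd, zpow_sub₀ hζ0, zpow_sub₀ hζ0, zpow_sub₀ hζ0,
      div_eq_one_iff_eq (div_ne_zero (zpow_ne_zero _ hζ0) (zpow_ne_zero _ hζ0))]
    simpa [div_eq_mul_inv] using h h₁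
  · rw [← (hζ.pow hm hpq).zpow_eq_one_iff_dvd, zpow_sub₀ hζp0,
      div_eq_one_iff_eq (zpow_ne_zero _ hζp0)]
    simpa using h h₂

end Characters

/-! ### Weight vectors -/

section CommonEigenvectors

variable {k V G' : Type*} [Field k] [AddCommGroup V] [Module k V]

theorem exists_common_eigenvector [IsAlgClosed k] [FiniteDimensional k V] [Nontrivial V]
    {T₁ T₂ : Module.End k V} (h : Commute T₁ T₂) :
    ∃ (v : V) (a b : k), T₁.HasEigenvector a v ∧ T₂.HasEigenvector b v := by
  obtain ⟨a, ha⟩ := Module.End.exists_eigenvalue T₁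
  have hmaps := Module.End.mapsTo_genEigenspace_of_comm h a 1
  have : Nontrivial (T₁.eigenspace a) := Submodule.nontrivial_iff_ne_bot.2 ha
  obtain ⟨b, hb⟩ := Module.End.exists_eigenvalue (T₂.restrict hmaps)
  obtain ⟨v, hv⟩ := hb.exists_hasEigenvector
  have hv0 : (v : V) ≠ 0 := fun h0 => hv.2 (Subtype.ext h0)
  exact ⟨v, a, b, ⟨v.2, hv0⟩,
    Module.End.mem_eigenspace_iff.2 (congrArg Subtype.val hv.apply_eq_smul), hv0⟩

theorem eigenvalue_pow_eq_one {T : Module.End k V} {a : k} {v : V} (hv : T.HasEigenvector a v)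
    {n : ℕ} (hT : T ^ n = 1) : a ^ n = 1 := by
  have h := hv.pow_apply n
  rw [hT, Module.End.one_apply] at h
  exact smul_left_injective k hv.2 (h.symm.trans (one_smul k v).symm)

theorem exists_apply_notMem_span_singleton [Monoid G'] {ρ : Representation k G' V}
    (hρ : ρ.IsIrreducible) (hV : Module.finrank k V ≠ 1) {v : V} (hv : v ≠ 0) :
    ∃ g, ρ g v ∉ Submodule.span k {v} := by
  by_contra! h
  let U : Subrepresentation ρ := ⟨Submodule.span k {v}, fun g w hw => by
    obtain ⟨c, rfl⟩ := Submodule.mem_span_singleton.1 hw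
    rw [map_smul]
    exact Submodule.smul_mem _ _ (h g)⟩
  rcases hρ.eq_bot_or_eq_top U with hU | hU
  · exact hv (Submodule.span_singleton_eq_bot.1 (congrArg Subrepresentation.toSubmodule hU))
  · have htop : Submodule.span k {v} = ⊤ := congrArg Subrepresentation.toSubmodule hU
    exact hV (by rw [← finrank_top, ← htop, finrank_span_singleton hv])

end CommonEigenvectors

section WeightVectors

variable {m p q : ℕ} {W W' : Type*} [AddCommGroup W] [Module ℂ W] [AddCommGroup W'] [Module ℂ W']
  {ρ : Representation ℂ (G m p) W} {ρ' : Representation ℂ (G m p) W'} {i k i' k' : ℕ} {v w : W}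

theorem apply_swapElem_apply_swapElem (ρ : Representation ℂ (G m p) W) (v : W) :
    ρ (swapElem m p) (ρ (swapElem m p) v) = v := by
  rw [← Module.End.mul_apply, ← map_mul, swapElem_mul_self, map_one, Module.End.one_apply]

/-- The diagonal elements of `G(m, p, 2)` act on `v` through the character
`diag(a, b) ↦ a^i b^k`. The zero vector is not excluded. -/
def IsWeightVector (ρ : Representation ℂ (G m p) W) (i k : ℕ) (v : W) : Prop :=
  ∀ ⦃g : G m p⦄ ⦃a b : ℂ⦄, mat g = !![a, 0; 0, b] → ρ g v = (a ^ i * b ^ k) • v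

namespace IsWeightVector

theorem congr (hpq : m = p * q) (hm : 0 < m) (h : charClass m q i k = charClass m q i' k')
    (hv : IsWeightVector ρ i k v) : IsWeightVector ρ i' k' v := fun g a b hg => by
  rw [hv hg, pow_mul_pow_eq_of_charClass_eq hpq hm h hg]

theorem zero : IsWeightVector ρ i k 0 := fun g a b _ => by
  rw [map_zero, smul_zero]

theorem add (hv : IsWeightVector ρ i k v) (hw : IsWeightVector ρ i k w) :
    IsWeightVector ρ i k (v + w) := fun g a b hg => by
  rw [map_add, hv hg, hw hg, smul_add]

theorem smul (c : ℂ) (hv : IsWeightVector ρ i k v) : IsWeightVector ρ i k (c • v) :=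
  fun g a b hg => by rw [map_smul, hv hg, smul_comm]

theorem map (f : ρ.IntertwiningMap ρ') (hv : IsWeightVector ρ i k v) :
    IsWeightVector ρ' i k (f v) := fun g a b hg => by
  rw [← f.isIntertwining, hv hg, map_smul]

theorem swap (hv : IsWeightVector ρ i k v) : IsWeightVector ρ k i (ρ (swapElem m p) v) :=
  fun g a b hg => by
  have hcomm : g * swapElem m p = swapElem m p * (swapElem m p * g * swapElem m p) := by
    simp only [← mul_assoc, swapElem_mul_self, one_mul]
  rw [← Module.End.mul_apply, ← map_mul, hcomm, map_mul, Module.End.mul_apply,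
    hv (mat_swapElem_mul_mul_swapElem hg), map_smul, mul_comm]

theorem twistDet (hv : IsWeightVector ρ i k v) :
    IsWeightVector (twistDet ρ) (i + 1) (k + 1) v := fun g a b hg => by
  change (mat g).det • ρ g v = _
  rw [hv hg, hg, Matrix.det_fin_two_of, smul_smul]
  congr 1
  ring

theorem apply_mem_span_singleton (hv : IsWeightVector ρ i k v)
    (hs : ρ (swapElem m p) v ∈ Submodule.span ℂ {v}) (g : G m p) :
    ρ g v ∈ Submodule.span ℂ {v} := by
  refine diag_swap_induction (fun hg => Submodule.mem_span_singleton.2 ⟨_, (hv hg).symm⟩) hs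
    (fun g h hg hh => ?_) g
  obtain ⟨c, hc⟩ := Submodule.mem_span_singleton.1 hh
  rw [map_mul, Module.End.mul_apply, ← hc, map_smul]
  exact Submodule.smul_mem _ c hg

theorem apply_swapElem_notMem_span_singleton (hv : IsWeightVector ρ i k v)
    (hρ : ρ.IsIrreducible) (hW : Module.finrank ℂ W ≠ 1) (hv0 : v ≠ 0) :
    ρ (swapElem m p) v ∉ Submodule.span ℂ {v} := fun hs =>
  have ⟨g, hg⟩ := exists_apply_notMem_span_singleton hρ hW hv0
  hg (hv.apply_mem_span_singleton hs g)

end IsWeightVector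

theorem commute_of_mat_eq_diag {g h : G m p} {a b c d : ℂ} (hg : mat g = !![a, 0; 0, b])
    (hh : mat h = !![c, 0; 0, d]) : Commute g h :=
  mat_injective (by rw [mat_mul, mat_mul, hg, hh, diag_mul, diag_mul, mul_comm a, mul_comm b])

theorem exists_isWeightVector (hpq : m = p * q) (hm : 0 < m) [FiniteDimensional ℂ W] [Nontrivial W]
    (ρ : Representation ℂ (G m p) W) : ∃ (i k : ℕ) (v : W), v ≠ 0 ∧ IsWeightVector ρ i k v := by
  obtain ⟨ζ, g₁, g₂, hζ, h₁, h₂⟩ := exists_diag_generators hpq hm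
  have hζ0 : ζ ≠ 0 := hζ.ne_zero hm.ne'
  have hζp : IsPrimitiveRoot (ζ ^ p) q := hζ.pow hm hpq
  have : NeZero m := ⟨hm.ne'⟩
  have : NeZero q := ⟨(q_pos_of_eq_mul hpq hm).ne'⟩
  obtain ⟨v, a₁, a₂, hv₁, hv₂⟩ :=
    exists_common_eigenvector ((commute_of_mat_eq_diag h₁ h₂).map ρ)
  have hg₁ : g₁ ^ m = 1 := mat_injective (by
    rw [mat_pow, h₁, diag_pow, mat_one, inv_pow, hζ.pow_eq_one, inv_one, Matrix.one_fin_two])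
  have hg₂ : g₂ ^ q = 1 := mat_injective (by
    rw [mat_pow, h₂, diag_pow, mat_one, hζp.pow_eq_one, one_pow, Matrix.one_fin_two])
  obtain ⟨u, -, rfl⟩ := hζ.eq_pow_of_pow_eq_one
    (eigenvalue_pow_eq_one hv₁ (by rw [← map_pow, hg₁, map_one]))
  obtain ⟨k, -, rfl⟩ := hζp.eq_pow_of_pow_eq_one
    (eigenvalue_pow_eq_one hv₂ (by rw [← map_pow, hg₂, map_one]))
  refine ⟨u + k, k, v, hv₁.2, fun g a b hg => ?_⟩
  obtain ⟨s, t, rfl⟩ := exists_eq_pow_mul_pow hpq hm hζ h₁ h₂ hg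
  rw [map_mul, map_pow, map_pow, Module.End.mul_apply, hv₂.pow_apply, map_smul, hv₁.pow_apply,
    smul_smul]
  obtain ⟨rfl, rfl⟩ : ζ ^ s = a ∧ (ζ ^ s)⁻¹ * (ζ ^ p) ^ t = b := by
    simpa [mat_mul, mat_pow, h₁, h₂, diag_pow, ← Matrix.ext_iff, Fin.forall_fin_two] using hg
  congr 1
  rw [mul_pow, inv_pow]
  field_simp
  ring

end WeightVectors

/-! ### Two-dimensional monomial representations -/

section PairBasis

variable {m p q : ℕ} {W W' : Type*} [AddCommGroup W] [Module ℂ W] [AddCommGroup W'] [Module ℂ W']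
  {ρ : Representation ℂ (G m p) W} {ρ' : Representation ℂ (G m p) W'} {i k i' k' : ℕ}
  {B : Module.Basis (Fin 2) ℂ W} {B' : Module.Basis (Fin 2) ℂ W'}

/-- The basis `B` identifies `ρ` with the restriction of `⟨i, k⟩`. The action on `B 1` is then
forced, since the transposition is an involution that exchanges the entries of diagonal matrices. -/
structure IsPairBasis (ρ : Representation ℂ (G m p) W) (i k : ℕ) (B : Module.Basis (Fin 2) ℂ W) :
    Prop where
  isWeightVector_zero : IsWeightVector ρ i k (B 0)
  apply_swapElem_zero : ρ (swapElem m p) (B 0) = B 1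

theorem isPairBasis_resPair (m p i k : ℕ) :
    IsPairBasis (resPair m p i k) i k (Pi.basisFun ℂ (Fin 2)) where
  isWeightVector_zero g a b hg := by
    change Matrix.mulVec (pairMatrix i k (mat g)) _ = _
    rw [hg]
    ext l
    fin_cases l <;> simp [pairMatrix]
  apply_swapElem_zero := by
    change Matrix.mulVec (pairMatrix i k (mat (swapElem m p))) _ = _
    rw [mat_swapElem]
    ext l
    fin_cases l <;> simp [pairMatrix]

namespace IsPairBasis

theorem apply_swapElem_one (h : IsPairBasis ρ i k B) : ρ (swapElem m p) (B 1) = B 0 := by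
  rw [← h.apply_swapElem_zero, apply_swapElem_apply_swapElem]

theorem isWeightVector_one (h : IsPairBasis ρ i k B) : IsWeightVector ρ k i (B 1) :=
  h.apply_swapElem_zero ▸ h.isWeightVector_zero.swap

theorem symm (h : IsPairBasis ρ i k B) : IsPairBasis ρ k i (B.reindex (Equiv.swap 0 1)) where
  isWeightVector_zero := by simpa using h.isWeightVector_one
  apply_swapElem_zero := by simpa using h.apply_swapElem_one

theorem congr (hpq : m = p * q) (hm : 0 < m) (h : IsPairBasis ρ i k B)
    (hik : charClass m q i k = charClass m q i' k') : IsPairBasis ρ i' k' B :=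
  ⟨h.isWeightVector_zero.congr hpq hm hik, h.apply_swapElem_zero⟩

theorem twistDet (h : IsPairBasis ρ i k B) :
    IsPairBasis (twistDet ρ) (i + 1) (k + 1) (B.unitsSMul ![1, -1]) where
  isWeightVector_zero := by
    simpa [Module.Basis.unitsSMul_apply] using h.isWeightVector_zero.twistDet
  apply_swapElem_zero := by
    change (mat (swapElem m p)).det • ρ (swapElem m p) _ = _
    simp [Module.Basis.unitsSMul_apply, mat_swapElem, h.apply_swapElem_zero, Units.smul_def]

theorem comp_eq_comp (h : IsPairBasis ρ i k B) {f : W →ₗ[ℂ] W'}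
    (h₀ : IsWeightVector ρ' i k (f (B 0))) (h₁ : f (B 1) = ρ' (swapElem m p) (f (B 0)))
    (g : G m p) : f ∘ₗ ρ g = ρ' g ∘ₗ f := by
  refine diag_swap_induction (P := fun g => f ∘ₗ ρ g = ρ' g ∘ₗ f) (fun hg => B.ext fun l => ?_)
    (B.ext fun l => ?_) (fun g₁ g₂ hg₁ hg₂ => ?_) g
  · fin_cases l
    · simp [h.isWeightVector_zero hg, h₀ hg]
    · simp [h.isWeightVector_one hg, h₁, h₀.swap hg]
  · fin_cases l
    · simp [h.apply_swapElem_zero, h₁]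
    · simp [h.apply_swapElem_one, h₁, apply_swapElem_apply_swapElem]
  · rw [map_mul, map_mul, Module.End.mul_eq_comp, Module.End.mul_eq_comp, ← LinearMap.comp_assoc,
      hg₁, LinearMap.comp_assoc, hg₂, LinearMap.comp_assoc]

theorem exists_intertwiningMap (h : IsPairBasis ρ i k B) {v : W'} (hv : IsWeightVector ρ' i k v) :
    ∃ f : ρ.IntertwiningMap ρ', f (B 0) = v := by
  have h0 : B.constr ℂ ![v, ρ' (swapElem m p) v] (B 0) = v := by simp
  have h1 : B.constr ℂ ![v, ρ' (swapElem m p) v] (B 1) = ρ' (swapElem m p) v := by simp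
  exact ⟨⟨_, h.comp_eq_comp (by rwa [h0]) (by rw [h1, h0])⟩, h0⟩

theorem nonempty_equiv (h : IsPairBasis ρ i k B) (h' : IsPairBasis ρ' i k B') :
    Nonempty (ρ.Equiv ρ') :=
  ⟨Representation.Equiv.mk (B.equiv B' (Equiv.refl _)) (h.comp_eq_comp
    (by simpa using h'.isWeightVector_zero) (by simp [h'.apply_swapElem_zero]))⟩

theorem basis_zero_mem_of_repr_ne_zero (hpq : m = p * q) (hm : 0 < m) (h : IsPairBasis ρ i k B)
    (hik : charClass m q i k ≠ charClass m q k i) (U : Subrepresentation ρ) {w : W}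
    (hw : w ∈ U.toSubmodule) (h0 : B.repr w 0 ≠ 0) : B 0 ∈ U.toSubmodule := by
  obtain ⟨g, a, b, hg, hab⟩ : ∃ (g : G m p) (a b : ℂ), mat g = !![a, 0; 0, b] ∧
      a ^ i * b ^ k ≠ a ^ k * b ^ i := by
    by_contra! hall
    exact hik (charClass_eq_of_pow_mul_pow_eq hpq hm fun hg => hall _ _ _ hg)
  have hmem : ρ g w - (a ^ k * b ^ i) • w ∈ U.toSubmodule :=
    sub_mem (U.apply_mem_toSubmodule g hw) (U.toSubmodule.smul_mem _ hw)
  have hproj : ρ g w - (a ^ k * b ^ i) • w =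
      ((a ^ i * b ^ k - a ^ k * b ^ i) * B.repr w 0) • B 0 := by
    nth_rw 1 2 [← B.sum_repr w]
    rw [Fin.sum_univ_two, map_add, map_smul, map_smul, h.isWeightVector_zero hg,
      h.isWeightVector_one hg]
    module
  rw [hproj] at hmem
  exact (Submodule.smul_mem_iff _ (mul_ne_zero (sub_ne_zero.2 hab) h0)).1 hmem

theorem basis_zero_mem_of_ne_bot (hpq : m = p * q) (hm : 0 < m) (h : IsPairBasis ρ i k B)
    (hik : charClass m q i k ≠ charClass m q k i) (U : Subrepresentation ρ)
    (hU : U.toSubmodule ≠ ⊥) : B 0 ∈ U.toSubmodule := by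
  obtain ⟨w, hw, hw0⟩ := (Submodule.ne_bot_iff _).1 hU
  obtain h0 | h1 : B.repr w 0 ≠ 0 ∨ B.repr w 1 ≠ 0 := by
    by_contra! hrepr
    exact hw0 (B.ext_elem fun l => by fin_cases l <;> simp [hrepr])
  · exact h.basis_zero_mem_of_repr_ne_zero hpq hm hik U hw h0
  · have hB := h.symm.basis_zero_mem_of_repr_ne_zero hpq hm hik.symm U hw (by simpa using h1)
    rw [← h.apply_swapElem_one]
    exact U.apply_mem_toSubmodule _ (by simpa using hB)

theorem isIrreducible (hpq : m = p * q) (hm : 0 < m) (h : IsPairBasis ρ i k B)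
    (hik : charClass m q i k ≠ charClass m q k i) : ρ.IsIrreducible := by
  have : Nontrivial W := ⟨B 0, 0, B.ne_zero 0⟩
  have : Nontrivial (Subrepresentation ρ) :=
    ⟨⊥, ⊤, fun h => bot_ne_top (congrArg Subrepresentation.toSubmodule h)⟩
  refine { eq_bot_or_eq_top := fun U => or_iff_not_imp_left.2 fun hU => ?_ }
  have h0 : B 0 ∈ U.toSubmodule := h.basis_zero_mem_of_ne_bot hpq hm hik U fun hbot =>
    hU (Subrepresentation.toSubmodule_injective hbot)
  have h1 : B 1 ∈ U.toSubmodule := h.apply_swapElem_zero ▸ U.apply_mem_toSubmodule _ h0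
  have htop : U.toSubmodule = ⊤ := by
    rw [eq_top_iff, ← B.span_eq, Submodule.span_le, Set.range_subset_iff, Fin.forall_fin_two]
    exact ⟨h0, h1⟩
  exact Subrepresentation.toSubmodule_injective htop

theorem charClass_ne_of_isIrreducible (hpq : m = p * q) (hm : 0 < m) (h : IsPairBasis ρ i k B)
    (hρ : ρ.IsIrreducible) : charClass m q i k ≠ charClass m q k i := fun hik => by
  have hW : Module.finrank ℂ W ≠ 1 := by simp [Module.finrank_eq_card_basis B]
  have hw : IsWeightVector ρ i k (B 0 + B 1) :=
    h.isWeightVector_zero.add (h.isWeightVector_one.congr hpq hm hik.symm)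
  have hw0 : B 0 + B 1 ≠ 0 := fun h0 => by simpa using congrArg (fun w => B.repr w 0) h0
  refine hw.apply_swapElem_notMem_span_singleton hρ hW hw0 ?_
  rw [map_add, h.apply_swapElem_zero, h.apply_swapElem_one, add_comm]
  exact Submodule.mem_span_singleton_self _

end IsPairBasis

theorem isIrreducible_resPair_iff (hpq : m = p * q) (hm : 0 < m) :
    (resPair m p i k).IsIrreducible ↔ charClass m q i k ≠ charClass m q k i :=
  ⟨(isPairBasis_resPair m p i k).charClass_ne_of_isIrreducible hpq hm,
    (isPairBasis_resPair m p i k).isIrreducible hpq hm⟩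

theorem exists_isPairBasis_of_isIrreducible (hpq : m = p * q) (hm : 0 < m) (hρ : ρ.IsIrreducible)
    (hW : Module.finrank ℂ W = 2) :
    ∃ (i k : ℕ) (B : Module.Basis (Fin 2) ℂ W), IsPairBasis ρ i k B := by
  have : FiniteDimensional ℂ W := Module.finite_of_finrank_pos (by omega)
  have : Nontrivial W := Module.nontrivial_of_finrank_pos (R := ℂ) (by omega)
  obtain ⟨i, k, v, hv0, hv⟩ := exists_isWeightVector hpq hm ρ
  have hli : LinearIndependent ℂ ![v, ρ (swapElem m p) v] := by
    refine (LinearIndependent.pair_iff' hv0).2 fun c hc => ?_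
    exact hv.apply_swapElem_notMem_span_singleton hρ (by omega) hv0
      (Submodule.mem_span_singleton.2 ⟨c, hc⟩)
  refine ⟨i, k, basisOfLinearIndependentOfCardEqFinrank hli (by simp [hW]), ?_, ?_⟩
  · simpa using hv
  · simp

end PairBasis

/-! ### Weight spaces of the polynomial ring -/

section PolynomialRing

variable {m p q i k i' k' : ℕ}

theorem polyRep_mul (g : G m p) (s t : S) :
    polyRep m p g (s * t) = polyRep m p g s * polyRep m p g t :=
  map_mul (subst (mat g)) s t

theorem polyRep_algebraMap (g : G m p) (r : R m p) :
    polyRep m p g (algebraMap (R m p) S r) = algebraMap (R m p) S r :=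
  r.2 g

theorem algebraMap_σ₁ (hpq : m = p * q) (hp : 0 < p) :
    algebraMap (R m p) S (σ₁ m p) = (X 0 * X 1) ^ q := by
  change (X 0 * X 1 : S) ^ (m / p) = _
  rw [Nat.div_eq_of_eq_mul_right hp hpq]

theorem algebraMap_σ₂ (m p : ℕ) : algebraMap (R m p) S (σ₂ m p) = X 0 ^ m + X 1 ^ m := rfl

theorem algebraMap_R_injective (m p : ℕ) : Function.Injective (algebraMap (R m p) S) :=
  Subtype.val_injective

instance : Algebra ℂ (R m p) := inferInstanceAs (Algebra ℂ (invariants m p))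

instance : IsScalarTower ℂ (R m p) S := inferInstanceAs (IsScalarTower ℂ (invariants m p) S)

/-- The exchange of `x` and `y`, which is the action of the transposition, as an automorphism of
`S` over `R`. -/
def swapHom (m p : ℕ) : S →ₐ[R m p] S where
  __ := subst (mat (swapElem m p))
  commutes' := polyRep_algebraMap (swapElem m p)

theorem polyRep_swapElem (s : S) : polyRep m p (swapElem m p) s = swapHom m p s := rfl

theorem swapHom_swapHom (s : S) : swapHom m p (swapHom m p s) = s :=
  apply_swapElem_apply_swapElem (polyRep m p) s

theorem swapHom_X_zero : swapHom m p (X 0) = X 1 := by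
  rw [← polyRep_swapElem]
  exact (subst_X _ 0).trans (by simp [mat_swapElem])

theorem swapHom_X_one : swapHom m p (X 1) = X 0 := by
  rw [← polyRep_swapElem]
  exact (subst_X _ 1).trans (by simp [mat_swapElem])

theorem swapHom_z : swapHom m p (z m) = -z m := by
  rw [← polyRep_swapElem, polyRep_z, mat_swapElem]
  simp

/-- The weight space of `S` for the character `diag(a, b) ↦ a^i b^k` of the diagonal subgroup, as
a module over the invariants. -/
def weightSpace (m p i k : ℕ) : Submodule (R m p) S where
  carrier := {s | IsWeightVector (polyRep m p) i k s}
  zero_mem' := IsWeightVector.zero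
  add_mem' := IsWeightVector.add
  smul_mem' r s hs g a b hg := by
    rw [Algebra.smul_def, polyRep_mul, polyRep_algebraMap, hs hg, mul_smul_comm]

theorem algebraMap_mem_weightSpace (r : R m p) : algebraMap (R m p) S r ∈ weightSpace m p 0 0 :=
  fun g a b _ => by rw [polyRep_algebraMap, pow_zero, pow_zero, one_mul, one_smul]

theorem z_mem_weightSpace : z m ∈ weightSpace m p 1 1 := fun g a b hg => by
  rw [polyRep_z, hg, Matrix.det_fin_two_of, mul_zero, sub_zero, pow_one, pow_one]

theorem mul_mem_weightSpace {s t : S} (hs : s ∈ weightSpace m p i k)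
    (ht : t ∈ weightSpace m p i' k') : s * t ∈ weightSpace m p (i + i') (k + k') :=
  fun g a b hg => by
  rw [polyRep_mul, hs hg, ht hg, smul_mul_smul_comm]
  congr 1
  ring

theorem monomial_mem_weightSpace (m p i k : ℕ) :
    (X 0 ^ i * X 1 ^ k : S) ∈ weightSpace m p i k := fun g a b hg => by
  change subst (mat g) _ = _
  rw [map_mul, map_pow, map_pow, subst_X, subst_X, hg, smul_eq_C_mul]
  simp only [Matrix.of_apply, Matrix.cons_val', Matrix.cons_val_zero, Matrix.cons_val_one,
    Matrix.cons_val_fin_one, C_0, zero_mul, add_zero, zero_add, mul_pow, C_mul, C_pow]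
  ring

theorem swapHom_mem_weightSpace {s : S} (hs : s ∈ weightSpace m p i k) :
    swapHom m p s ∈ weightSpace m p k i :=
  IsWeightVector.swap hs

theorem weightSpace_congr (hpq : m = p * q) (hm : 0 < m)
    (h : charClass m q i k = charClass m q i' k') : weightSpace m p i k = weightSpace m p i' k' :=
  le_antisymm (fun _ hs => IsWeightVector.congr hpq hm h hs)
    (fun _ hs => IsWeightVector.congr hpq hm h.symm hs)

theorem coeff_polyRep_of_mat_eq_diag {g : G m p} {a b : ℂ} (hg : mat g = !![a, 0; 0, b])
    (d : Fin 2 →₀ ℕ) (s : S) :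
    coeff d (polyRep m p g s) = a ^ d 0 * b ^ d 1 * coeff d s := by
  induction s using MvPolynomial.induction_on' with
  | monomial e c =>
    have he : monomial e c = c • (X 0 ^ e 0 * X 1 ^ e 1 : S) := by
      rw [monomial_eq, Finsupp.prod_fintype _ _ (by simp), Fin.prod_univ_two, smul_eq_C_mul]
    have hw : polyRep m p g (monomial e c) = (a ^ e 0 * b ^ e 1) • monomial e c := by
      rw [he, map_smul, monomial_mem_weightSpace m p _ _ hg, smul_comm]
    classical
    rw [hw, coeff_smul, smul_eq_mul, coeff_monomial]
    split_ifs with hed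
    · rw [hed]
    · rw [mul_zero, mul_zero]
  | add s t hs ht => rw [map_add, coeff_add, coeff_add, hs, ht, mul_add]

theorem mem_weightSpace_iff_isWeightedHomogeneous (hpq : m = p * q) (hm : 0 < m) {s : S} :
    s ∈ weightSpace m p i k ↔
      IsWeightedHomogeneous (charWeight m q) s (charClass m q i k) := by
  constructor
  · intro hs d hd
    rw [weight_charWeight]
    refine charClass_eq_of_pow_mul_pow_eq hpq hm fun {g a b} hg => mul_right_cancel₀ hd ?_
    rw [← coeff_polyRep_of_mat_eq_diag hg, hs hg, coeff_smul, smul_eq_mul]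
  · intro hs g a b hg
    ext d
    rw [coeff_polyRep_of_mat_eq_diag hg, coeff_smul, smul_eq_mul]
    by_cases hd : coeff d s = 0
    · rw [hd, mul_zero, mul_zero]
    · have hw := hs hd
      rw [weight_charWeight] at hw
      rw [pow_mul_pow_eq_of_charClass_eq hpq hm hw hg]

end PolynomialRing

section WeightProjection

theorem weightedHomogeneousComponent_mul_of_mem {A σ Γ : Type*} [CommSemiring A]
    [AddCancelCommMonoid Γ] {w : σ → Γ} {a : Γ} {f : MvPolynomial σ A}
    (hf : IsWeightedHomogeneous w f a) (b : Γ) (s : MvPolynomial σ A) :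
    weightedHomogeneousComponent w (a + b) (f * s) = f * weightedHomogeneousComponent w b s := by
  induction s using MvPolynomial.induction_on' with
  | monomial d c =>
    have hd : IsWeightedHomogeneous w (monomial d c) (Finsupp.weight w d) :=
      isWeightedHomogeneous_monomial w d c rfl
    by_cases h : Finsupp.weight w d = b
    · rw [← h, (hf.mul hd).weightedHomogeneousComponent_same,
        hd.weightedHomogeneousComponent_same]
    · rw [(hf.mul hd).weightedHomogeneousComponent_ne _ (fun h' => h (add_left_cancel h').symm),
        hd.weightedHomogeneousComponent_ne _ (Ne.symm h), mul_zero]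
  | add s t hs ht => rw [mul_add, map_add, map_add, hs, ht, mul_add]

variable {m p q i k i' k' : ℕ} (hpq : m = p * q) (hm : 0 < m)

/-- The `R`-linear projection of `S` to a weight space: a weighted homogeneous component for the
grading of `S` by the characters of the diagonal subgroup. -/
def weightProj (i k : ℕ) : S →ₗ[R m p] S where
  toFun := weightedHomogeneousComponent (charWeight m q) (charClass m q i k)
  map_add' := map_add _
  map_smul' r s := by
    have h := weightedHomogeneousComponent_mul_of_mem
      ((mem_weightSpace_iff_isWeightedHomogeneous hpq hm).1 (algebraMap_mem_weightSpace r))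
      (charClass m q i k) s
    rw [← charClass_add, zero_add, zero_add] at h
    rw [Algebra.smul_def, h, RingHom.id_apply, Algebra.smul_def]

theorem weightProj_mem (i k : ℕ) (s : S) : weightProj hpq hm i k s ∈ weightSpace m p i k :=
  (mem_weightSpace_iff_isWeightedHomogeneous hpq hm).2
    (weightedHomogeneousComponent_isWeightedHomogeneous _ _)

theorem weightProj_of_mem {s : S} (hs : s ∈ weightSpace m p i k) : weightProj hpq hm i k s = s :=
  ((mem_weightSpace_iff_isWeightedHomogeneous hpq hm).1 hs).weightedHomogeneousComponent_same

theorem weightProj_eq_zero_of_mem {s : S} (hs : s ∈ weightSpace m p i k)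
    (h : charClass m q i k ≠ charClass m q i' k') : weightProj hpq hm i' k' s = 0 :=
  ((mem_weightSpace_iff_isWeightedHomogeneous hpq hm).1 hs).weightedHomogeneousComponent_ne _ h.symm

theorem weightProj_z_mul (i k : ℕ) (s : S) :
    weightProj hpq hm (i + 1) (k + 1) (z m * s) = z m * weightProj hpq hm i k s := by
  have h := weightedHomogeneousComponent_mul_of_mem
    ((mem_weightSpace_iff_isWeightedHomogeneous hpq hm).1 z_mem_weightSpace)
    (charClass m q i k) s
  rwa [← charClass_add, add_comm 1, add_comm 1] at h

include hpq hm in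
theorem disjoint_weightSpace (h : charClass m q i k ≠ charClass m q i' k') :
    Disjoint (weightSpace m p i k) (weightSpace m p i' k') :=
  Submodule.disjoint_def.2 fun s hs hs' => by
    rw [← weightProj_of_mem hpq hm hs, weightProj_eq_zero_of_mem hpq hm hs' h.symm]

end WeightProjection

section IsotypicalComponents

variable {m p q : ℕ} {W : Type*} [AddCommGroup W] [Module ℂ W]
  {ρ : Representation ℂ (G m p) W} {i k : ℕ} {B : Module.Basis (Fin 2) ℂ W}

namespace IsPairBasis

theorem isotypic_eq (h : IsPairBasis ρ i k B) :
    isotypic ρ = weightSpace m p i k ⊔ weightSpace m p k i := by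
  apply le_antisymm
  · refine Submodule.span_le.2 ?_
    rintro _ ⟨f, w, rfl⟩
    rw [← B.sum_repr w, Fin.sum_univ_two, map_add, map_smul, map_smul]
    exact add_mem
      (Submodule.mem_sup_left ((h.isWeightVector_zero.map f).smul _))
      (Submodule.mem_sup_right ((h.isWeightVector_one.map f).smul _))
  · refine sup_le (fun s hs => ?_) (fun s hs => ?_)
    · obtain ⟨f, rfl⟩ := h.exists_intertwiningMap hs
      exact Submodule.subset_span ⟨f, _, rfl⟩
    · obtain ⟨f, rfl⟩ := h.symm.exists_intertwiningMap hs
      exact Submodule.subset_span ⟨f, _, rfl⟩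

end IsPairBasis

end IsotypicalComponents

/-! ### Bases of the weight spaces -/

section WeightSpaceBasis

variable {m p q : ℕ}

/-- Two monomials of the same weight `(a, jq + b)`, which form a basis of the weight space over `R`
when `a, b < q` and `j ≤ p`. -/
def weightGen (p q a b j : ℕ) : Fin 2 → S :=
  ![X 0 ^ a * X 1 ^ (j * q + b), X 0 ^ ((p - j) * q + a) * X 1 ^ b]

section Span

variable {j : ℕ} (hpq : m = p * q) (hp : 0 < p) (hj : j ≤ p) (a b : ℕ)

include hpq hp

theorem σ₁_pow_smul (n : ℕ) (s : S) : σ₁ m p ^ n • s = (X 0 * X 1) ^ (n * q) * s := by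
  rw [Algebra.smul_def, map_pow, algebraMap_σ₁ hpq hp, ← pow_mul, mul_comm q]

include hj

theorem X_zero_pow_mul_weightGen_zero :
    X 0 ^ m * weightGen p q a b j 0 = σ₁ m p ^ j • weightGen p q a b j 1 := by
  obtain ⟨t, rfl⟩ := Nat.exists_eq_add_of_le hj
  rw [σ₁_pow_smul hpq hp, hpq]
  simp only [weightGen, Matrix.cons_val_zero, Matrix.cons_val_one, Nat.add_sub_cancel_left]
  ring

theorem X_one_pow_mul_weightGen_one :
    X 1 ^ m * weightGen p q a b j 1 = σ₁ m p ^ (p - j) • weightGen p q a b j 0 := by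
  obtain ⟨t, rfl⟩ := Nat.exists_eq_add_of_le hj
  rw [σ₁_pow_smul hpq hp, hpq]
  simp only [weightGen, Matrix.cons_val_zero, Matrix.cons_val_one, Nat.add_sub_cancel_left]
  ring

theorem X_zero_pow_mul_weightGen_one :
    X 0 ^ m * weightGen p q a b j 1 =
      σ₂ m p • weightGen p q a b j 1 - σ₁ m p ^ (p - j) • weightGen p q a b j 0 := by
  rw [← X_one_pow_mul_weightGen_one hpq hp hj, Algebra.smul_def, algebraMap_σ₂]
  ring

theorem X_one_pow_mul_weightGen_zero :
    X 1 ^ m * weightGen p q a b j 0 =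
      σ₂ m p • weightGen p q a b j 0 - σ₁ m p ^ j • weightGen p q a b j 1 := by
  rw [← X_zero_pow_mul_weightGen_zero hpq hp hj, Algebra.smul_def, algebraMap_σ₂]
  ring

theorem X_pow_mul_weightGen_mem_span (l n : Fin 2) :
    X l ^ m * weightGen p q a b j n ∈
      Submodule.span (R m p) (Set.range (weightGen p q a b j)) := by
  have smul_mem (r : R m p) (n : Fin 2) := Submodule.smul_mem _ r
    (Submodule.subset_span (R := R m p) (Set.mem_range_self (f := weightGen p q a b j) n))
  match l, n with
  | 0, 0 =>
    rw [X_zero_pow_mul_weightGen_zero hpq hp hj]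
    exact smul_mem _ _
  | 0, 1 =>
    rw [X_zero_pow_mul_weightGen_one hpq hp hj]
    exact sub_mem (smul_mem _ _) (smul_mem _ _)
  | 1, 0 =>
    rw [X_one_pow_mul_weightGen_zero hpq hp hj]
    exact sub_mem (smul_mem _ _) (smul_mem _ _)
  | 1, 1 =>
    rw [X_one_pow_mul_weightGen_one hpq hp hj]
    exact smul_mem _ _

theorem X_pow_pow_mul_mem_span_weightGen (l : Fin 2) (n : ℕ) {s : S}
    (hs : s ∈ Submodule.span (R m p) (Set.range (weightGen p q a b j))) :
    (X l ^ m) ^ n * s ∈ Submodule.span (R m p) (Set.range (weightGen p q a b j)) := by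
  have hle : Submodule.span (R m p) (Set.range (weightGen p q a b j)) ≤
      (Submodule.span (R m p) (Set.range (weightGen p q a b j))).comap
        (LinearMap.mulLeft (R m p) (X l ^ m)) := by
    refine Submodule.span_le.2 ?_
    rintro _ ⟨n, rfl⟩
    exact X_pow_mul_weightGen_mem_span hpq hp hj a b l n
  induction n with
  | zero => rwa [pow_zero, one_mul]
  | succ n ih =>
    rw [pow_succ', mul_assoc]
    exact hle ih

omit hpq hp in
theorem exists_eq_or_exists_eq_of_dvd_sub_add {s t : ℕ} (h : (p : ℤ) ∣ s - t + j) :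
    (∃ n, t = s + j + p * n) ∨ ∃ n, s = t + (p - j) + p * n := by
  obtain ⟨c, hc⟩ := h
  rcases le_or_gt c 0 with hc0 | hc0
  · obtain ⟨n, rfl⟩ := Int.exists_eq_neg_ofNat hc0
    exact .inl ⟨n, by zify; linear_combination -hc⟩
  · obtain ⟨n, rfl⟩ := Int.eq_succ_of_zero_lt hc0
    exact .inr ⟨n, by zify [hj]; linear_combination hc⟩

theorem monomial_mem_span_weightGen {s t : ℕ} (h : (p : ℤ) ∣ s - t + j) :
    (X 0 ^ (a + s * q) * X 1 ^ (b + t * q) : S) ∈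
      Submodule.span (R m p) (Set.range (weightGen p q a b j)) := by
  have gen_mem (l : Fin 2) : weightGen p q a b j l ∈
      Submodule.span (R m p) (Set.range (weightGen p q a b j)) := Submodule.subset_span ⟨l, rfl⟩
  rcases exists_eq_or_exists_eq_of_dvd_sub_add hj h with ⟨n, rfl⟩ | ⟨n, rfl⟩
  · convert Submodule.smul_mem _ (σ₁ m p ^ s)
      (X_pow_pow_mul_mem_span_weightGen hpq hp hj a b 1 n (gen_mem 0)) using 1
    rw [σ₁_pow_smul hpq hp, hpq]
    simp only [weightGen, Matrix.cons_val_zero]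
    ring
  · convert Submodule.smul_mem _ (σ₁ m p ^ t)
      (X_pow_pow_mul_mem_span_weightGen hpq hp hj a b 0 n (gen_mem 1)) using 1
    rw [σ₁_pow_smul hpq hp, hpq]
    simp only [weightGen, Matrix.cons_val_one, Matrix.cons_val_zero]
    ring

end Span

theorem exists_eq_add_mul_of_dvd_sub {q a c : ℕ} (ha : a < q) (h : (q : ℤ) ∣ c - a) :
    ∃ s : ℕ, c = a + s * q := by
  have hmod : a ≡ c [MOD q] := Nat.modEq_iff_dvd.2 h
  refine ⟨c / q, ?_⟩
  rw [← Nat.mod_eq_of_lt ha, hmod, Nat.mod_add_div']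

theorem exists_exponents_of_charClass_eq (hpq : m = p * q) {a b j c d : ℕ} (ha : a < q)
    (hb : b < q) (h : charClass m q c d = charClass m q a (j * q + b)) :
    ∃ s t : ℕ, c = a + s * q ∧ d = b + t * q ∧ (p : ℤ) ∣ s - t + j := by
  obtain ⟨hm, hq⟩ := charClass_eq_iff.1 h
  have hqm : (q : ℤ) ∣ m := ⟨p, by rw [hpq]; push_cast; ring⟩
  have hd : (q : ℤ) ∣ d - b := by
    rw [show (d : ℤ) - b = d - (j * q + b : ℕ) + q * j by push_cast; ring]
    exact dvd_add hq (dvd_mul_right _ _)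
  have hc : (q : ℤ) ∣ c - a := by
    rw [show (c : ℤ) - a = c - d - (a - (j * q + b : ℕ)) + (d - (j * q + b : ℕ)) by ring]
    exact dvd_add (hqm.trans hm) hq
  obtain ⟨s, rfl⟩ := exists_eq_add_mul_of_dvd_sub ha hc
  obtain ⟨t, rfl⟩ := exists_eq_add_mul_of_dvd_sub hb hd
  refine ⟨s, t, rfl, rfl, ?_⟩
  rw [← mul_dvd_mul_iff_right (show (q : ℤ) ≠ 0 by omega), ← Nat.cast_mul, ← hpq]
  rwa [show ((s : ℤ) - t + j) * q =
    (a + s * q : ℕ) - (b + t * q : ℕ) - (a - (j * q + b : ℕ)) by push_cast; ring]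

variable (hpq : m = p * q) (hm : 0 < m) {i k a b j : ℕ}

include hpq hm

theorem mem_span_weightGen (ha : a < q) (hb : b < q) (hj : j ≤ p) {s : S}
    (hs : s ∈ weightSpace m p a (j * q + b)) :
    s ∈ Submodule.span (R m p) (Set.range (weightGen p q a b j)) := by
  rw [s.as_sum]
  refine sum_mem fun d hd => ?_
  have hclass := (mem_weightSpace_iff_isWeightedHomogeneous hpq hm).1 hs (mem_support_iff.1 hd)
  rw [weight_charWeight] at hclass
  obtain ⟨u, t, hu, ht, hdvd⟩ := exists_exponents_of_charClass_eq hpq ha hb hclass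
  have hmono := monomial_mem_span_weightGen hpq (p_pos_of_eq_mul hpq hm) hj a b hdvd
  rw [← hu, ← ht] at hmono
  convert Submodule.smul_mem _ (algebraMap ℂ (R m p) (coeff d s)) hmono using 1
  rw [algebraMap_smul, monomial_eq, Finsupp.prod_fintype _ _ (by simp), Fin.prod_univ_two,
    smul_eq_C_mul]

theorem weightGen_mem_weightSpace (hj : j ≤ p) (l : Fin 2) :
    weightGen p q a b j l ∈ weightSpace m p a (j * q + b) := by
  match l with
  | 0 => exact monomial_mem_weightSpace m p a (j * q + b)
  | 1 =>
    rw [weightSpace_congr hpq hm (charClass_eq_iff (i' := (p - j) * q + a) (k' := b).2 ?_)]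
    · exact monomial_mem_weightSpace m p ((p - j) * q + a) b
    · exact ⟨⟨-1, by rw [hpq]; push_cast [hj]; ring⟩, ⟨j, by push_cast; ring⟩⟩

omit hpq in
theorem X_pow_sub_X_pow_ne_zero : (X 1 ^ m - X 0 ^ m : S) ≠ 0 := by
  intro h
  have := congrArg (aeval (![0, 1] : Fin 2 → ℂ)) h
  simp [hm.ne'] at this

/-- Exchanging `x` and `y` in a relation gives a second one, and the determinant of the resulting
system is a monomial multiple of `y^m - x^m`. -/
theorem linearIndependent_weightGen (hj : j ≤ p) :
    LinearIndependent (R m p) (weightGen p q a b j) := by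
  rw [Fintype.linearIndependent_iff]
  intro r hr
  set r₀ := algebraMap (R m p) S (r 0) with hr₀
  set r₁ := algebraMap (R m p) S (r 1) with hr₁
  have hrel : r₀ * X 1 ^ (j * q) + r₁ * X 0 ^ ((p - j) * q) = 0 := by
    have hx : (X 0 ^ a * X 1 ^ b : S) ≠ 0 :=
      mul_ne_zero (pow_ne_zero _ (X_ne_zero _)) (pow_ne_zero _ (X_ne_zero _))
    apply mul_left_cancel₀ hx
    rw [mul_zero, ← hr, Fin.sum_univ_two, Algebra.smul_def, Algebra.smul_def, ← hr₀, ← hr₁]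
    simp only [weightGen, Matrix.cons_val_zero, Matrix.cons_val_one]
    ring
  have hswap : r₀ * X 0 ^ (j * q) + r₁ * X 1 ^ ((p - j) * q) = 0 := by
    have := congrArg (swapHom m p) hrel
    simpa only [map_add, map_mul, map_pow, map_zero, swapHom_X_zero, swapHom_X_one, hr₀, hr₁,
      AlgHom.commutes] using this
  have hmj : m = j * q + (p - j) * q := by rw [hpq, ← add_mul, Nat.add_sub_cancel' hj]
  have eq_zero_of_mul {s : R m p} (h : algebraMap (R m p) S s * (X 1 ^ m - X 0 ^ m) = 0) : s = 0 :=
    algebraMap_R_injective m p <|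
      ((mul_eq_zero.1 h).resolve_right (X_pow_sub_X_pow_ne_zero hm)).trans (map_zero _).symm
  rw [Fin.forall_fin_two]
  constructor
  · apply eq_zero_of_mul
    rw [← hr₀, hmj, pow_add, pow_add]
    linear_combination X 1 ^ ((p - j) * q) * hrel - X 0 ^ ((p - j) * q) * hswap
  · apply eq_zero_of_mul
    rw [← hr₁, hmj, pow_add, pow_add]
    linear_combination X 1 ^ (j * q) * hswap - X 0 ^ (j * q) * hrel

theorem exists_basis_weightSpace (ha : a < q) (hb : b < q) (hj : j ≤ p)
    (hc : charClass m q i k = charClass m q a (j * q + b)) (u : Fin 2 → (R m p)ˣ) :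
    ∃ e : Module.Basis (Fin 2) (R m p) (weightSpace m p i k),
      ∀ l, (e l : S) = u l • weightGen p q a b j l := by
  rw [weightSpace_congr hpq hm hc]
  have hmem := weightGen_mem_weightSpace hpq hm (a := a) (b := b) hj
  let v (l : Fin 2) : weightSpace m p a (j * q + b) := ⟨weightGen p q a b j l, hmem l⟩
  have hv : LinearIndependent (R m p) v :=
    .of_comp (weightSpace m p a (j * q + b)).subtype (linearIndependent_weightGen hpq hm hj)
  have hspan : ⊤ ≤ Submodule.span (R m p) (Set.range v) := by
    rintro ⟨s, hs⟩ -
    obtain ⟨r, hr⟩ := (Submodule.mem_span_range_iff_exists_fun _).1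
      (mem_span_weightGen hpq hm ha hb hj hs)
    refine (Submodule.mem_span_range_iff_exists_fun _).2 ⟨r, Subtype.ext ?_⟩
    rwa [AddSubmonoidClass.coe_finsetSum]
  exact ⟨(Module.Basis.mk hv hspan).unitsSMul u, fun l => by
    rw [Module.Basis.unitsSMul_apply, Module.Basis.mk_apply]; rfl⟩

end WeightSpaceBasis

/-! ### The modules `M_ρ` as cokernels -/

section Cokernels

variable {A N N' P P' : Type*} [CommRing A] [AddCommGroup N] [Module A N] [AddCommGroup N']
  [Module A N'] [AddCommGroup P] [Module A P] [AddCommGroup P'] [Module A P']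

theorem map_equiv_range_of_comp_eq {f : N →ₗ[A] N'} {g : P →ₗ[A] P'} (e : N ≃ₗ[A] P)
    (e' : N' ≃ₗ[A] P') (h : g ∘ₗ e = e' ∘ₗ f) :
    (LinearMap.range f).map (e' : N' →ₗ[A] P') = LinearMap.range g := by
  rw [← LinearMap.range_comp, ← h, LinearMap.range_comp_of_range_eq_top _ e.range]

/-- The cokernel of a linear map, computed by its matrix in bases of the source and target. -/
def quotientRangeEquivCoker (e : Module.Basis (Fin 2) A N) (f : Module.Basis (Fin 2) A N')
    (φ : N →ₗ[A] N') : (N' ⧸ LinearMap.range φ) ≃ₗ[A] Coker (LinearMap.toMatrix e f φ) :=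
  Submodule.Quotient.equiv _ _ f.equivFun <| map_equiv_range_of_comp_eq e.equivFun f.equivFun <|
    LinearMap.ext fun x => LinearMap.toMatrix_mulVec_repr e f φ x

theorem toMatrix_eq_of_apply_eq_sum {e : Module.Basis (Fin 2) A N} {f : Module.Basis (Fin 2) A N'}
    {φ : N →ₗ[A] N'} {Φ : Matrix (Fin 2) (Fin 2) A} (h : ∀ l, φ (e l) = ∑ n, Φ n l • f n) :
    LinearMap.toMatrix e f φ = Φ := by
  ext n l
  rw [LinearMap.toMatrix_apply, h, Module.Basis.repr_sum_self]

/-- The cokernel of a product of linear maps is the product of the cokernels. -/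
def quotientRangeProdMapEquiv (f : N →ₗ[A] N') (g : P →ₗ[A] P') :
    ((N' × P') ⧸ LinearMap.range (f.prodMap g)) ≃ₗ[A]
      (N' ⧸ LinearMap.range f) × (P' ⧸ LinearMap.range g) :=
  Submodule.quotEquivOfEq _ _ (by
      rw [LinearMap.ker_prodMap, Submodule.ker_mkQ, Submodule.ker_mkQ, LinearMap.range_prodMap]) ≪≫ₗ
    ((LinearMap.range f).mkQ.prodMap (LinearMap.range g).mkQ).quotKerEquivOfSurjective
      ((Submodule.mkQ_surjective _).prodMap (Submodule.mkQ_surjective _))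

end Cokernels

section MultiplicationByZ

variable {m p q : ℕ} {W : Type*} [AddCommGroup W] [Module ℂ W]
  {ρ : Representation ℂ (G m p) W} {i k : ℕ} {B : Module.Basis (Fin 2) ℂ W}

theorem z_mul_mem_weightSpace {s : S} (hs : s ∈ weightSpace m p i k) :
    LinearMap.mulLeft (R m p) (z m) s ∈ weightSpace m p (i + 1) (k + 1) := by
  rw [add_comm i, add_comm k]
  exact mul_mem_weightSpace z_mem_weightSpace hs

/-- Multiplication by `z` between weight spaces. -/
def zWeight (m p i k : ℕ) : weightSpace m p i k →ₗ[R m p] weightSpace m p (i + 1) (k + 1) :=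
  (LinearMap.mulLeft (R m p) (z m)).restrict fun _ => z_mul_mem_weightSpace

/-- The map `(u, v) ↦ u + v'` on pairs of weight vectors of the same weight, where `v'` is `v` with
`x` and `y` exchanged. -/
def pairSum (m p i k : ℕ) : weightSpace m p i k × weightSpace m p i k →ₗ[R m p] S :=
  (weightSpace m p i k).subtype.coprod
    ((swapHom m p).toLinearMap ∘ₗ (weightSpace m p i k).subtype)

theorem range_pairSum : LinearMap.range (pairSum m p i k) =
    weightSpace m p i k ⊔ weightSpace m p k i := by
  have hswap : LinearMap.range ((swapHom m p).toLinearMap ∘ₗ (weightSpace m p i k).subtype) =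
      weightSpace m p k i := by
    ext s
    constructor
    · rintro ⟨t, rfl⟩
      exact swapHom_mem_weightSpace t.2
    · exact fun hs => ⟨⟨_, swapHom_mem_weightSpace hs⟩, swapHom_swapHom s⟩
  rw [pairSum, LinearMap.range_coprod, Submodule.range_subtype, hswap]

theorem pairSum_injective (hpq : m = p * q) (hm : 0 < m)
    (hik : charClass m q i k ≠ charClass m q k i) : Function.Injective (pairSum m p i k) := by
  rw [injective_iff_map_eq_zero]
  rintro ⟨u, v⟩ h
  have hu : (u : S) = swapHom m p (-v) := by
    rw [map_neg, ← add_eq_zero_iff_eq_neg]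
    exact h
  have hu₀ : (u : S) = 0 := Submodule.disjoint_def.1 (disjoint_weightSpace hpq hm hik) u u.2
    (hu ▸ swapHom_mem_weightSpace (neg_mem v.2))
  have hv₀ : (v : S) = 0 := by
    rw [hu₀] at hu
    have := congrArg (swapHom m p) hu
    rwa [swapHom_swapHom, map_zero, zero_eq_neg] at this
  exact Prod.ext (Subtype.ext hu₀) (Subtype.ext hv₀)

namespace IsPairBasis

variable (hpq : m = p * q) (hm : 0 < m) (h : IsPairBasis ρ i k B)
  (hik : charClass m q i k ≠ charClass m q k i)

/-- The isotypical component of a pair representation as two copies of one of its weight spaces. -/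
def isotypicEquiv : (weightSpace m p i k × weightSpace m p i k) ≃ₗ[R m p] isotypic ρ :=
  LinearEquiv.ofInjective _ (pairSum_injective hpq hm hik) ≪≫ₗ
    LinearEquiv.ofEq _ _ (range_pairSum.trans h.isotypic_eq.symm)

/-- The sign comes from `z`, which is skew under the exchange of `x` and `y`. -/
theorem zRestrict_comp_isotypicEquiv :
    zRestrict ρ ∘ₗ h.isotypicEquiv hpq hm hik =
      h.twistDet.isotypicEquiv hpq hm (charClass_succ_ne_swap hik) ∘ₗ
        (zWeight m p i k).prodMap (-zWeight m p i k) := by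
  refine LinearMap.ext fun x => Subtype.ext ?_
  change z m * (x.1 + swapHom m p x.2) = z m * x.1 + swapHom m p (-(z m * x.2))
  rw [map_neg, map_mul, swapHom_z]
  ring

/-- `M_ρ` as two copies of the cokernel of `z` between weight spaces. -/
def mEquiv : M ρ ≃ₗ[R m p]
    (weightSpace m p (i + 1) (k + 1) ⧸ LinearMap.range (zWeight m p i k)) ×
      (weightSpace m p (i + 1) (k + 1) ⧸ LinearMap.range (zWeight m p i k)) :=
  (Submodule.Quotient.equiv _ _ _ (map_equiv_range_of_comp_eq _ _
      (h.zRestrict_comp_isotypicEquiv hpq hm hik))).symm ≪≫ₗ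
    quotientRangeProdMapEquiv _ _ ≪≫ₗ
    LinearEquiv.prodCongr (.refl _ _) (Submodule.quotEquivOfEq _ _ (LinearMap.range_neg _))

include hpq hm h hik in
theorem nonempty_M_equiv {e : Module.Basis (Fin 2) (R m p) (weightSpace m p i k)}
    {f : Module.Basis (Fin 2) (R m p) (weightSpace m p (i + 1) (k + 1))}
    {Φ : Matrix (Fin 2) (Fin 2) (R m p)} (hΦ : ∀ l, z m * (e l : S) = ∑ n, Φ n l • (f n : S)) :
    Nonempty (M ρ ≃ₗ[R m p] Coker Φ × Coker Φ) := by
  have hz : LinearMap.toMatrix e f (zWeight m p i k) = Φ :=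
    toMatrix_eq_of_apply_eq_sum fun l => Subtype.ext <| by
      rw [Submodule.coe_sum]
      exact hΦ l
  subst hz
  exact ⟨h.mEquiv hpq hm hik ≪≫ₗ
    (quotientRangeEquivCoker e f _).prodCongr (quotientRangeEquivCoker e f _)⟩

end IsPairBasis

end MultiplicationByZ

/-! ### Direct summands of `S/(z)` -/

section DirectSummand

theorem exists_isCompl_range_of_leftInverse {A N P : Type*} [CommRing A] [AddCommGroup N]
    [Module A N] [AddCommGroup P] [Module A P] {f : N →ₗ[A] P} {π : P →ₗ[A] N}
    (h : Function.LeftInverse π f) : ∃ C : Submodule A P, IsCompl (LinearMap.range f) C := by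
  have hπf : π ∘ₗ f = LinearMap.id := LinearMap.ext h
  have hidem : IsIdempotentElem (f ∘ₗ π : Module.End A P) := by
    change (f ∘ₗ π) ∘ₗ (f ∘ₗ π) = f ∘ₗ π
    rw [LinearMap.comp_assoc, ← LinearMap.comp_assoc π, hπf, LinearMap.id_comp]
  rw [← LinearMap.range_comp_of_range_eq_top f (LinearMap.range_eq_top.2 h.surjective)]
  exact ⟨_, LinearMap.IsIdempotentElem.isCompl hidem⟩

variable {m p q : ℕ} {W : Type*} [AddCommGroup W] [Module ℂ W]
  {ρ : Representation ℂ (G m p) W} {i k : ℕ} {B : Module.Basis (Fin 2) ℂ W}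

section Projection

variable (hpq : m = p * q) (hm : 0 < m) (h : IsPairBasis ρ i k B)

namespace IsPairBasis

/-- The projection of `S` to the isotypical component of a pair representation. -/
def isotypicProj : S →ₗ[R m p] isotypic ρ :=
  (weightProj hpq hm i k + weightProj hpq hm k i).codRestrict _ fun s => by
    rw [h.isotypic_eq]
    exact Submodule.add_mem_sup (weightProj_mem hpq hm i k s) (weightProj_mem hpq hm k i s)

theorem isotypicProj_coe (hik : charClass m q i k ≠ charClass m q k i) (s : isotypic ρ) :
    h.isotypicProj hpq hm s = s := by
  apply Subtype.ext
  have hs : (s : S) ∈ weightSpace m p i k ⊔ weightSpace m p k i := h.isotypic_eq.le s.2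
  obtain ⟨u, hu, v, hv, hs⟩ := Submodule.mem_sup.1 hs
  change weightProj hpq hm i k s + weightProj hpq hm k i s = s
  rw [← hs, map_add, map_add, weightProj_of_mem hpq hm hu, weightProj_of_mem hpq hm hv,
    weightProj_eq_zero_of_mem hpq hm hu hik, weightProj_eq_zero_of_mem hpq hm hv hik.symm,
    add_zero, zero_add]

theorem isotypicProj_z_mul (s : S) :
    h.twistDet.isotypicProj hpq hm (z m * s) = zRestrict ρ (h.isotypicProj hpq hm s) :=
  Subtype.ext <| by
    change weightProj hpq hm (i + 1) (k + 1) (z m * s) +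
      weightProj hpq hm (k + 1) (i + 1) (z m * s) =
        z m * (weightProj hpq hm i k s + weightProj hpq hm k i s)
    rw [weightProj_z_mul, weightProj_z_mul, mul_add]

/-- The retraction of `S/(z)` onto `M_ρ` induced by the projection to the isotypical component. -/
def toM : SmodZ m →ₗ[R m p] M ρ :=
  ((Ideal.span {z m}).restrictScalars (R m p)).liftQ
      ((LinearMap.range (zRestrict ρ)).mkQ ∘ₗ h.twistDet.isotypicProj hpq hm) (fun s hs => by
        obtain ⟨t, rfl⟩ := Ideal.mem_span_singleton.1 hs
        rw [LinearMap.mem_ker, LinearMap.comp_apply, h.isotypicProj_z_mul, Submodule.mkQ_apply,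
          Submodule.Quotient.mk_eq_zero]
        exact LinearMap.mem_range_self _ _) ∘ₗ
    (Submodule.Quotient.restrictScalarsEquiv (R m p) (Ideal.span {z m})).symm.toLinearMap

theorem leftInverse_toM (hik : charClass m q i k ≠ charClass m q k i) :
    Function.LeftInverse (h.toM hpq hm) (toSmodZ ρ) := fun x => by
  obtain ⟨s, rfl⟩ := Submodule.mkQ_surjective _ x
  change Submodule.mkQ _ (h.twistDet.isotypicProj hpq hm s) = Submodule.mkQ _ s
  rw [h.twistDet.isotypicProj_coe hpq hm (charClass_succ_ne_swap hik)]

end IsPairBasis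

end Projection

section Torsion

theorem algebraMap_Δ (hpq : m = p * q) (hm : 0 < m) :
    algebraMap (R m p) S (Δ m p) = z m * ((X 0 * X 1) ^ (q - 1) * (X 0 ^ m - X 1 ^ m)) := by
  obtain ⟨n, rfl⟩ := Nat.exists_eq_add_of_le' (q_pos_of_eq_mul hpq hm)
  have hσ₁ : (((X 0 * X 1) ^ (n + 1)) ^ p : S) = X 0 ^ m * X 1 ^ m := by
    rw [← pow_mul, mul_comm (n + 1), ← mul_pow, hpq]
  rw [Δ, map_mul, map_sub, map_mul, map_pow, map_pow, algebraMap_σ₁ hpq (p_pos_of_eq_mul hpq hm),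
    algebraMap_σ₂, map_ofNat, hσ₁, z, Nat.add_sub_cancel]
  ring

theorem isTorsionBySet_SmodZ (hpq : m = p * q) (hm : 0 < m) :
    Module.IsTorsionBySet (R m p) (SmodZ m) (discIdeal m p) := by
  rw [discIdeal, Module.isTorsionBySet_span_singleton_iff]
  intro x
  obtain ⟨s, rfl⟩ := Ideal.Quotient.mk_surjective x
  change Ideal.Quotient.mk (Ideal.span {z m}) (Δ m p • s) = 0
  rw [Ideal.Quotient.eq_zero_iff_mem, Algebra.smul_def, algebraMap_Δ hpq hm, mul_assoc]
  exact Ideal.mul_mem_right _ _ (Ideal.mem_span_singleton_self _)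

theorem isTorsionBySet_of_injective {A N P : Type*} [CommRing A] [AddCommGroup N]
    [Module A N] [AddCommGroup P] [Module A P] {s : Set A} {f : N →ₗ[A] P}
    (hf : Function.Injective f) (hP : Module.IsTorsionBySet A P s) :
    Module.IsTorsionBySet A N s := fun x a =>
  hf <| by
    rw [map_smul, map_zero]
    exact @hP (f x) a

theorem isoMod_of_linearEquiv {A : Type*} [CommRing A] {I : Ideal A} {N P : Type*}
    [AddCommGroup N] [Module A N] [AddCommGroup P] [Module A P]
    (hN : Module.IsTorsionBySet A N I) (e : N ≃ₗ[A] P) : IsoMod I N P := by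
  have hP : Module.IsTorsionBySet A P I := isTorsionBySet_of_injective e.symm.injective hN
  let := hN.module
  let := hP.module
  exact ⟨hN, hP, ⟨{ e.toAddEquiv with
    map_smul' := Ideal.Quotient.mk_surjective.forall.2 e.map_smul }⟩⟩

theorem IsPairBasis.isTorsionBySet_M (hpq : m = p * q) (hm : 0 < m) (h : IsPairBasis ρ i k B)
    (hik : charClass m q i k ≠ charClass m q k i) :
    Module.IsTorsionBySet (R m p) (M ρ) (discIdeal m p) :=
  isTorsionBySet_of_injective (h.leftInverse_toM hpq hm hik).injective
    (isTorsionBySet_SmodZ hpq hm)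

theorem IsoMod.of_linearEquiv_right {A : Type*} [CommRing A] {I : Ideal A} {N P P' : Type*}
    [AddCommGroup N] [Module A N] [AddCommGroup P] [Module A P] [AddCommGroup P'] [Module A P']
    (h : IsoMod I N P) (e : P ≃ₗ[A] P') : IsoMod I P P' :=
  let ⟨_, hP, _⟩ := h
  isoMod_of_linearEquiv hP e

end Torsion

end DirectSummand

/-! ### The three families of modules -/

section Cases

variable {m p q : ℕ}

theorem X_mul_X_mul_weightGen (p q a b j : ℕ) (l : Fin 2) :
    X 0 * X 1 * weightGen p q a b j l = weightGen p q (a + 1) (b + 1) j l := by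
  fin_cases l <;> simp [weightGen] <;> ring

section Multiplication

variable {j : ℕ} (hpq : m = p * q) (hp : 0 < p)

include hpq hp

theorem z_mul_weightGen_zero (hj : j ≤ p) (a b : ℕ) :
    z m * weightGen p q a b j 0 =
      (2 * σ₁ m p ^ j) • weightGen p q (a + 1) (b + 1) j 1 -
        σ₂ m p • weightGen p q (a + 1) (b + 1) j 0 := by
  rw [z, mul_right_comm, X_mul_X_mul_weightGen, mul_comm _ (X 0 ^ m - X 1 ^ m), sub_mul,
    mul_smul, two_smul, X_zero_pow_mul_weightGen_zero hpq hp hj,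
    X_one_pow_mul_weightGen_zero hpq hp hj]
  abel

theorem z_mul_weightGen_one (hj : j ≤ p) (a b : ℕ) :
    z m * weightGen p q a b j 1 =
      σ₂ m p • weightGen p q (a + 1) (b + 1) j 1 -
        (2 * σ₁ m p ^ (p - j)) • weightGen p q (a + 1) (b + 1) j 0 := by
  rw [z, mul_right_comm, X_mul_X_mul_weightGen, mul_comm _ (X 0 ^ m - X 1 ^ m), sub_mul,
    mul_smul, two_smul, X_zero_pow_mul_weightGen_one hpq hp hj,
    X_one_pow_mul_weightGen_one hpq hp hj]
  abel

theorem weightGen_right_eq_q_one (hj : j + 1 ≤ p) (a : ℕ) :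
    weightGen p q a q j 1 = σ₁ m p • weightGen p q a 0 (j + 1) 1 := by
  obtain ⟨t, rfl⟩ := Nat.exists_eq_add_of_le hj
  rw [← pow_one (σ₁ _ _), σ₁_pow_smul hpq hp]
  simp only [weightGen, Matrix.cons_val_one, Matrix.cons_val_zero, Nat.add_sub_cancel_left,
    show j + 1 + t - j = t + 1 by omega]
  ring

theorem weightGen_q_q (j : ℕ) (l : Fin 2) :
    weightGen p q q q j l = σ₁ m p • weightGen p q 0 0 j l := by
  rw [← pow_one (σ₁ _ _), σ₁_pow_smul hpq hp]
  fin_cases l <;> simp [weightGen] <;> ring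

end Multiplication

theorem weightGen_right_eq_q_zero (p q a j : ℕ) :
    weightGen p q a q j 0 = weightGen p q a 0 (j + 1) 0 := by
  simp only [weightGen, Matrix.cons_val_zero, add_zero, add_mul, one_mul]

section Isomorphisms

variable {W : Type*} [AddCommGroup W] [Module ℂ W] {ρ : Representation ℂ (G m p) W} {i j r : ℕ}
  {B : Module.Basis (Fin 2) ℂ W} (hpq : m = p * q) (hm : 0 < m)

namespace IsPairBasis

include hpq hm

theorem nonempty_M_equiv_KMod (h : IsPairBasis ρ i (j * q + r) B)
    (hik : charClass m q i (j * q + r) ≠ charClass m q (j * q + r) i)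
    (hi : i + 1 < q) (hj : j ≤ p) (hr : r + 1 < q) :
    Nonempty (M ρ ≃ₗ[R m p] KMod m p (p - j) × KMod m p (p - j)) := by
  have hp := p_pos_of_eq_mul hpq hm
  obtain ⟨e, he⟩ := exists_basis_weightSpace hpq hm (Nat.lt_of_succ_lt hi) (Nat.lt_of_succ_lt hr)
    hj (i := i) (k := j * q + r) rfl 1
  obtain ⟨f, hf⟩ := exists_basis_weightSpace hpq hm hi hr hj
    (i := i + 1) (k := j * q + r + 1) rfl ![-1, 1]
  refine h.nonempty_M_equiv hpq hm hik (e := e) (f := f) fun l => ?_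
  rw [he, Fin.sum_univ_two, hf, hf, Pi.one_apply, one_smul]
  match l with
  | 0 => simp [z_mul_weightGen_zero hpq hp hj, φMat, Nat.sub_sub_self hj, sub_eq_neg_add]
  | 1 => simp [z_mul_weightGen_one hpq hp hj, φMat, sub_eq_neg_add]

theorem nonempty_M_equiv_XMod (h : IsPairBasis ρ i (j * q + (q - 1)) B)
    (hik : charClass m q i (j * q + (q - 1)) ≠ charClass m q (j * q + (q - 1)) i)
    (hi : i + 1 < q) (hj : j + 1 ≤ p) :
    Nonempty (M ρ ≃ₗ[R m p] XMod m p (p - j) × XMod m p (p - j)) := by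
  have hp := p_pos_of_eq_mul hpq hm
  have hq := q_pos_of_eq_mul hpq hm
  have hq' : q - 1 + 1 = q := Nat.sub_add_cancel hq
  have hj' : j ≤ p := Nat.le_of_succ_le hj
  obtain ⟨e, he⟩ := exists_basis_weightSpace hpq hm (Nat.lt_of_succ_lt hi) (Nat.sub_one_lt hq.ne')
    hj' (i := i) (k := j * q + (q - 1)) rfl 1
  obtain ⟨f, hf⟩ := exists_basis_weightSpace hpq hm hi hq hj
    (i := i + 1) (k := j * q + (q - 1) + 1)
    (by rw [add_assoc, hq', add_zero, add_mul, one_mul]) ![-1, 1]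
  refine h.nonempty_M_equiv hpq hm hik (e := e) (f := f) fun l => ?_
  rw [he, Fin.sum_univ_two, hf, hf, Pi.one_apply, one_smul]
  match l with
  | 0 =>
    rw [z_mul_weightGen_zero hpq hp hj', hq', weightGen_right_eq_q_zero,
      weightGen_right_eq_q_one hpq hp hj, smul_smul]
    simp [ξMat, show p + 1 - (p - j) = j + 1 by omega, mul_assoc, ← pow_succ, sub_eq_neg_add]
  | 1 =>
    rw [z_mul_weightGen_one hpq hp hj', hq', weightGen_right_eq_q_zero,
      weightGen_right_eq_q_one hpq hp hj, smul_smul]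
    simp [ξMat, sub_eq_neg_add]

theorem nonempty_M_equiv_NMod (h : IsPairBasis ρ (q - 1) (j * q + (q - 1)) B)
    (hik : charClass m q (q - 1) (j * q + (q - 1)) ≠ charClass m q (j * q + (q - 1)) (q - 1))
    (hj : j ≤ p) : Nonempty (M ρ ≃ₗ[R m p] NMod m p (p - j) × NMod m p (p - j)) := by
  have hp := p_pos_of_eq_mul hpq hm
  have hq := q_pos_of_eq_mul hpq hm
  have hq' : q - 1 + 1 = q := Nat.sub_add_cancel hq
  obtain ⟨e, he⟩ := exists_basis_weightSpace hpq hm (Nat.sub_one_lt hq.ne')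
    (Nat.sub_one_lt hq.ne') hj (i := q - 1) (k := j * q + (q - 1)) rfl ![-1, 1]
  have hc : charClass m q (q - 1 + 1) (j * q + (q - 1) + 1) = charClass m q 0 (j * q + 0) := by
    rw [add_assoc, hq', charClass_eq_iff]
    constructor <;> simp
  obtain ⟨f, hf⟩ := exists_basis_weightSpace hpq hm hq hq hj hc 1
  refine h.nonempty_M_equiv hpq hm hik (e := e) (f := f) fun l => ?_
  rw [he, Fin.sum_univ_two, hf, hf]
  simp only [Pi.one_apply, one_smul]
  match l with
  | 0 =>
    simp [z_mul_weightGen_zero hpq hp hj, hq', weightGen_q_q hpq hp, smul_smul, ψMat,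
      show p + 1 - (p - j) = j + 1 by omega, pow_succ, mul_assoc, sub_eq_add_neg]
  | 1 =>
    simp [z_mul_weightGen_one hpq hp hj, hq', weightGen_q_q hpq hp, smul_smul, ψMat, pow_succ,
      mul_assoc, sub_eq_neg_add]

end IsPairBasis

/-- Exchanging both the rows and the columns of a matrix does not change its cokernel. -/
def cokerSwapEquiv {A : Type*} [CommRing A] {Φ Ψ : Matrix (Fin 2) (Fin 2) A}
    (h : Φ.submatrix (Equiv.swap 0 1) (Equiv.swap 0 1) = Ψ) : Coker Ψ ≃ₗ[A] Coker Φ :=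
  let e := LinearEquiv.funCongrLeft A A (Equiv.swap (0 : Fin 2) 1)
  Submodule.Quotient.equiv _ _ e <| map_equiv_range_of_comp_eq e e <| LinearMap.ext fun v => by
    subst h
    ext l
    fin_cases l <;> simp [e, LinearEquiv.funCongrLeft_apply, Matrix.mulVec, dotProduct, add_comm]

theorem φMat_submatrix_swap (m : ℕ) (hj : j ≤ p) :
    (φMat m p j).submatrix (Equiv.swap 0 1) (Equiv.swap 0 1) = φMat m p (p - j) := by
  ext k l
  fin_cases k <;> fin_cases l <;> simp [φMat, Nat.sub_sub_self hj]

theorem ψMat_submatrix_swap (m : ℕ) (hj : j ≤ p) :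
    (ψMat m p j).submatrix (Equiv.swap 0 1) (Equiv.swap 0 1) = ψMat m p (p - j) := by
  ext k l
  fin_cases k <;> fin_cases l <;>
    simp [ψMat, Nat.sub_add_comm hj, show p + 1 - (p - j) = j + 1 by omega]

end Isomorphisms

end Cases

/-! ### Classification of the two-dimensional irreducible representations -/

section Classification

variable {m p q : ℕ} (hpq : m = p * q) (hm : 0 < m)

include hpq hm

theorem exists_charClass_eq_mod (i k : ℕ) :
    ∃ j < p, charClass m q i k = charClass m q (i % q) (j * q + k % q) := by
  have hp : (0 : ℤ) < p := Int.natCast_pos.2 (p_pos_of_eq_mul hpq hm)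
  let n : ℤ := k / q - i / q
  obtain ⟨j, hj⟩ := Int.eq_ofNat_of_zero_le (Int.emod_nonneg n hp.ne')
  refine ⟨j, Int.ofNat_lt.1 (hj ▸ Int.emod_lt_of_pos n hp), charClass_eq_iff.2
    ⟨⟨-(n / p), ?_⟩, ⟨k / q - j, ?_⟩⟩⟩
  · have hn := Int.emod_add_mul_ediv n p
    rw [hj] at hn
    rw [hpq]
    push_cast
    linear_combination -Int.emod_add_mul_ediv i q + Int.emod_add_mul_ediv k q + q * hn
  · push_cast
    linear_combination -Int.emod_add_mul_ediv k q

theorem exists_charClass_eq_normalForm (i k : ℕ) :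
    (∃ a, ∃ j < p, a + 1 < q ∧ (charClass m q i k = charClass m q a (j * q + (q - 1)) ∨
      charClass m q k i = charClass m q a (j * q + (q - 1)))) ∨
    (∃ a, ∃ j < p, ∃ r, a + 1 < q ∧ r + 1 < q ∧
      charClass m q i k = charClass m q a (j * q + r)) ∨
    ∃ j < p, charClass m q i k = charClass m q (q - 1) (j * q + (q - 1)) := by
  have mod_cases (n : ℕ) : n % q + 1 < q ∨ n % q = q - 1 := by
    have := Nat.mod_lt n (q_pos_of_eq_mul hpq hm)
    omega
  obtain ⟨j, hj, h⟩ := exists_charClass_eq_mod hpq hm i k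
  rcases mod_cases i with hi | hi <;> rcases mod_cases k with hk | hk
  · exact .inr (.inl ⟨_, j, hj, _, hi, hk, h⟩)
  · exact .inl ⟨_, j, hj, hi, .inl (hk ▸ h)⟩
  · obtain ⟨j', hj', h'⟩ := exists_charClass_eq_mod hpq hm k i
    exact .inl ⟨_, j', hj', hk, .inr (hi ▸ h')⟩
  · rw [hi, hk] at h
    exact .inr (.inr ⟨j, hj, h⟩)

variable {W : Type*} [AddCommGroup W] [Module ℂ W] {ρ : Representation ℂ (G m p) W}

theorem exists_equiv_resPair_normalForm (hρ : ρ.IsIrreducible) (hW : Module.finrank ℂ W = 2) :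
    (∃ a, ∃ j < p, a + 1 < q ∧ Nonempty (ρ.Equiv (resPair m p a (j * q + (q - 1))))) ∨
    (∃ a, ∃ j < p, ∃ r, a + 1 < q ∧ r + 1 < q ∧ a ≠ j * q + r ∧
      Nonempty (ρ.Equiv (resPair m p a (j * q + r)))) ∨
    ∃ j < p, 1 ≤ j ∧ Nonempty (ρ.Equiv (resPair m p (q - 1) (j * q + (q - 1)))) := by
  obtain ⟨i, k, B, h⟩ := exists_isPairBasis_of_isIrreducible hpq hm hρ hW
  have equiv {i k a b : ℕ} {B : Module.Basis (Fin 2) ℂ W} (h : IsPairBasis ρ i k B)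
      (hc : charClass m q i k = charClass m q a b) : Nonempty (ρ.Equiv (resPair m p a b)) :=
    (h.congr hpq hm hc).nonempty_equiv (isPairBasis_resPair m p a b)
  have ne {a b : ℕ} (hc : charClass m q i k = charClass m q a b) : a ≠ b := by
    rintro rfl
    exact (h.congr hpq hm hc).charClass_ne_of_isIrreducible hpq hm hρ rfl
  rcases exists_charClass_eq_normalForm hpq hm i k with
    ⟨a, j, hj, ha, hc | hc⟩ | ⟨a, j, hj, r, ha, hr, hc⟩ | ⟨j, hj, hc⟩
  · exact .inl ⟨a, j, hj, ha, equiv h hc⟩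
  · exact .inl ⟨a, j, hj, ha, equiv h.symm hc⟩
  · exact .inr (.inl ⟨a, j, hj, r, ha, hr, ne hc, equiv h hc⟩)
  · refine .inr (.inr ⟨j, hj, Nat.one_le_iff_ne_zero.2 ?_, equiv h hc⟩)
    rintro rfl
    exact ne hc (by rw [zero_mul, zero_add])

end Classification

section NormalForms

variable {m p q : ℕ}

theorem succ_mul_sub_one (j : ℕ) (hq : 0 < q) : (j + 1) * q - 1 = j * q + (q - 1) := by
  rw [add_mul, one_mul, Nat.add_sub_assoc hq]

theorem charClass_ne_swap_of_add_one_lt {i : ℕ} (j : ℕ) (hi : i + 1 < q) :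
    charClass m q i (j * q + (q - 1)) ≠ charClass m q (j * q + (q - 1)) i := fun h => by
  obtain ⟨t, ht⟩ := (charClass_eq_swap_iff.1 h).2
  have hdvd : (q : ℤ) ∣ (i + 1 : ℕ) := ⟨t + j + 1, by
    push_cast [Nat.cast_sub (show 1 ≤ q by omega)] at ht ⊢
    linear_combination ht⟩
  exact Nat.not_dvd_of_pos_of_lt i.succ_pos hi (Int.natCast_dvd_natCast.1 hdvd)

theorem charClass_ne_swap_of_odd {i k : ℕ} (hpq : m = p * q) (hm : 0 < m) (hp : Odd p)
    (hi : i < m) (hk : k < m) (hik : i ≠ k) : charClass m q i k ≠ charClass m q k i := fun h => by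
  obtain ⟨h₁, t, ht⟩ := charClass_eq_swap_iff.1 h
  have hq : (q : ℤ) ≠ 0 := Nat.cast_ne_zero.2 (q_pos_of_eq_mul hpq hm).ne'
  have hpt : (p : ℤ) ∣ 2 * t := by
    rw [ht, hpq, Nat.cast_mul, mul_comm (p : ℤ), mul_left_comm] at h₁
    exact (mul_dvd_mul_iff_left hq).1 h₁
  have hp2 : IsCoprime (p : ℤ) 2 := Nat.isCoprime_iff_coprime.2 (Nat.coprime_two_right.2 hp)
  have hdvd : (m : ℤ) ∣ i - k := by
    rw [ht, hpq, Nat.cast_mul, mul_comm (p : ℤ)]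
    exact mul_dvd_mul_left _ (hp2.dvd_of_dvd_mul_left hpt)
  exact hik ((Nat.modEq_iff_dvd.2 hdvd).symm.eq_of_lt_of_lt hi hk)

end NormalForms

end ReflDisc

end

open ReflDisc in
theorem mainTheorem4_general (m p q : ℕ) (hm : 0 < m) (hpq : m = p * q) :
    (∀ i k : ℕ, (resPair m p i k).IsIrreducible ↔
      ¬((m : ℤ) ∣ 2 * (i - k) ∧ (q : ℤ) ∣ i - k)) ∧
    (∀ (W : Type*) [AddCommGroup W] [Module ℂ W] (ρ : Representation ℂ (G m p) W),
      ρ.IsIrreducible → Module.finrank ℂ W = 2 →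
        (∃ i j : ℕ, i + 1 < q ∧ 1 ≤ j ∧ j ≤ p ∧
          Nonempty (ρ.Equiv (resPair m p i (j * q - 1)))) ∨
        (∃ i j r : ℕ, i + 1 < q ∧ j + 1 ≤ p ∧ r + 1 < q ∧ i ≠ j * q + r ∧
          Nonempty (ρ.Equiv (resPair m p i (j * q + r)))) ∨
        (∃ j : ℕ, 1 ≤ j ∧ j + 1 ≤ p ∧
          Nonempty (ρ.Equiv (resPair m p (q - 1) ((j + 1) * q - 1))))) ∧
    Module.IsTorsionBySet (R m p) (SmodZ m) (discIdeal m p) ∧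
    (∀ i k : ℕ, (resPair m p i k).IsIrreducible →
      Function.Injective (toSmodZ (resPair m p i k)) ∧
      ∃ N : Submodule (R m p) (SmodZ m),
        IsCompl (LinearMap.range (toSmodZ (resPair m p i k))) N) ∧
    (∀ i j : ℕ, i + 1 < q → 1 ≤ j → j ≤ p →
      IsoMod (discIdeal m p) (M (resPair m p i (j * q - 1)))
        (XMod m p (p + 1 - j) × XMod m p (p + 1 - j))) ∧
    (∀ i j r : ℕ, i + 1 < q → j + 1 ≤ p → r + 1 < q →
      (resPair m p i (j * q + r)).IsIrreducible →
      IsoMod (discIdeal m p) (M (resPair m p i (j * q + r)))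
        (KMod m p (p - j) × KMod m p (p - j)) ∧
      IsoMod (discIdeal m p) (KMod m p (p - j) × KMod m p (p - j))
        (KMod m p j × KMod m p j)) ∧
    (∀ j : ℕ, j + 1 ≤ p → (resPair m p (q - 1) ((j + 1) * q - 1)).IsIrreducible →
      IsoMod (discIdeal m p) (M (resPair m p (q - 1) ((j + 1) * q - 1)))
        (NMod m p (p - j) × NMod m p (p - j)) ∧
      IsoMod (discIdeal m p) (NMod m p (p - j) × NMod m p (p - j))
        (NMod m p j × NMod m p j)) := by
  have hq := q_pos_of_eq_mul hpq hm
  have pair := isPairBasis_resPair m p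
  have irr {i k} : (resPair m p i k).IsIrreducible ↔ charClass m q i k ≠ charClass m q k i :=
    isIrreducible_resPair_iff hpq hm
  refine ⟨fun i k => irr.trans charClass_eq_swap_iff.not, fun W _ _ ρ hρ hW => ?_,
    isTorsionBySet_SmodZ hpq hm, fun i k hik => ?_, fun i j hi hj₁ hj => ?_,
    fun i j r hi hj hr hik => ?_, fun j hj hik => ?_⟩
  · rcases exists_equiv_resPair_normalForm hpq hm hρ hW with
      ⟨a, j, hj, ha, e⟩ | ⟨a, j, hj, r, ha, hr, har, e⟩ | ⟨j, hj, hj₁, e⟩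
    · exact .inl ⟨a, j + 1, ha, j.succ_pos, hj, succ_mul_sub_one j hq ▸ e⟩
    · exact .inr (.inl ⟨a, j, r, ha, hj, hr, har, e⟩)
    · exact .inr (.inr ⟨j, hj₁, hj, succ_mul_sub_one j hq ▸ e⟩)
  · have hinv := (pair i k).leftInverse_toM hpq hm (irr.1 hik)
    exact ⟨hinv.injective, exists_isCompl_range_of_leftInverse hinv⟩
  · obtain ⟨j, rfl⟩ := Nat.exists_eq_add_of_le' hj₁
    rw [succ_mul_sub_one j hq, Nat.add_sub_add_right]
    have hik := charClass_ne_swap_of_add_one_lt (m := m) j hi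
    obtain ⟨e⟩ := (pair _ _).nonempty_M_equiv_XMod hpq hm hik hi hj
    exact isoMod_of_linearEquiv ((pair _ _).isTorsionBySet_M hpq hm hik) e
  · obtain ⟨e⟩ := (pair _ _).nonempty_M_equiv_KMod hpq hm (irr.1 hik) hi (by omega) hr
    have hM := isoMod_of_linearEquiv ((pair _ _).isTorsionBySet_M hpq hm (irr.1 hik)) e
    have e' := cokerSwapEquiv (φMat_submatrix_swap m (show j ≤ p by omega))
    exact ⟨hM, hM.of_linearEquiv_right (e'.prodCongr e')⟩
  · rw [succ_mul_sub_one j hq] at hik ⊢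
    obtain ⟨e⟩ := (pair _ _).nonempty_M_equiv_NMod hpq hm (irr.1 hik) (by omega)
    have hM := isoMod_of_linearEquiv ((pair _ _).isTorsionBySet_M hpq hm (irr.1 hik)) e
    have e' := cokerSwapEquiv (ψMat_submatrix_swap m (show j ≤ p by omega))
    exact ⟨hM, hM.of_linearEquiv_right (e'.prodCongr e')⟩

open ReflDisc in
theorem mainTheorem4 (m p q : ℕ) (hm : 0 < m) (hpq : m = p * q) (hp : Odd p) (hmp : m ≠ p) :
    -- the representations `Res ⟨i, k⟩` are irreducible
    (∀ i k : ℕ, i < m → k < m → i ≠ k → (resPair m p i k).IsIrreducible) ∧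
    -- the list below contains every two-dimensional irreducible representation of `H`
    (∀ (W : Type*) [AddCommGroup W] [Module ℂ W] (ρ : Representation ℂ (G m p) W),
      ρ.IsIrreducible → Module.finrank ℂ W = 2 →
        (∃ i j : ℕ, i + 1 < q ∧ 1 ≤ j ∧ j ≤ p ∧
          Nonempty (ρ.Equiv (resPair m p i (j * q - 1)))) ∨
        (∃ i j r : ℕ, i + 1 < q ∧ j + 1 ≤ p ∧ r + 1 < q ∧ i ≠ j * q + r ∧
          Nonempty (ρ.Equiv (resPair m p i (j * q + r)))) ∨
        (∃ j : ℕ, 1 ≤ j ∧ j + 1 ≤ p ∧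
          Nonempty (ρ.Equiv (resPair m p (q - 1) ((j + 1) * q - 1))))) ∧
    -- the modules `M_ρ` are direct summands of the `R/(Δ)`-module `S/(z)`
    Module.IsTorsionBySet (R m p) (SmodZ m) (discIdeal m p) ∧
    (∀ i k : ℕ, i < m → k < m → i ≠ k →
      Function.Injective (toSmodZ (resPair m p i k)) ∧
      ∃ N : Submodule (R m p) (SmodZ m),
        IsCompl (LinearMap.range (toSmodZ (resPair m p i k))) N) ∧
    -- 1)
    (∀ i j : ℕ, i + 1 < q → 1 ≤ j → j ≤ p →
      IsoMod (discIdeal m p) (M (resPair m p i (j * q - 1)))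
        (XMod m p (p + 1 - j) × XMod m p (p + 1 - j))) ∧
    -- 2)
    (∀ i j r : ℕ, i + 1 < q → j + 1 ≤ p → r + 1 < q → i ≠ j * q + r →
      IsoMod (discIdeal m p) (M (resPair m p i (j * q + r)))
        (KMod m p (p - j) × KMod m p (p - j)) ∧
      IsoMod (discIdeal m p) (KMod m p (p - j) × KMod m p (p - j))
        (KMod m p j × KMod m p j)) ∧
    -- 3)
    (∀ j : ℕ, 1 ≤ j → j + 1 ≤ p →
      IsoMod (discIdeal m p) (M (resPair m p (q - 1) ((j + 1) * q - 1)))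
        (NMod m p (p - j) × NMod m p (p - j)) ∧
      IsoMod (discIdeal m p) (NMod m p (p - j) × NMod m p (p - j))
        (NMod m p j × NMod m p j)) := by
  have hq := q_pos_of_eq_mul hpq hm
  have irr {i k : ℕ} (hi : i < m) (hk : k < m) (hik : i ≠ k) : (resPair m p i k).IsIrreducible :=
    (isIrreducible_resPair_iff hpq hm).2 (charClass_ne_swap_of_odd hpq hm hp hi hk hik)
  have lt {j r : ℕ} (hj : j + 1 ≤ p) (hr : r < q) : j * q + r < m := by
    rw [hpq]
    nlinarith
  have lt_m {r : ℕ} (hr : r < q) : r < m :=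
    hr.trans_le (Nat.le_of_dvd hm (Dvd.intro_left p hpq.symm))
  obtain ⟨-, hlist, htors, hsummand, hX, hK, hN⟩ := mainTheorem4_general m p q hm hpq
  refine ⟨fun i k => irr, hlist, htors, fun i k hi hk hik => hsummand i k (irr hi hk hik), hX,
    fun i j r hi hj hr hir => ?_, fun j hj₁ hj => hN j hj ?_⟩
  · exact hK i j r hi hj hr
      (irr (lt_m (Nat.lt_of_succ_lt hi)) (lt hj (Nat.lt_of_succ_lt hr)) hir)
  · rw [succ_mul_sub_one j hq]
    have hq' : q - 1 < q := Nat.sub_one_lt hq.ne'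
    exact irr (lt_m hq') (lt hj hq') (by simp [hq.ne', Nat.ne_of_gt hj₁])
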